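/- Let $r\ge 0$ be an integer, $k$ a field, $u\in k$ with $u\neq 0$, and put $v=u^2$ (so $v^{1/2}:=u$) and $q=v^{-(r+1)}$. Let $z_1,\dots,z_{r+1}$ be variables subject only to $z_1z_2\cdots z_{r+1}=1$, and let $K$ be the field of rational functions of ${\mathbf z}=(z_1,\dots,z_{r+1})$ over $k$. Let $D_i$ be the shift operator $(D_if)(z_1,\dots,z_{r+1})=f(vz_1,\dots,qvz_i,\dots,vz_{r+1})$. For $I\subset[1,r+1]$ put $$z_I=\prod_{i\in I}z_i,\qquad D_I=\prod_{i\in I}D_i,\qquad a_I({\mathbf z})=\prod_{i\in I,\ j\notin I}\frac{z_i}{z_i-z_j},$$ and put $\Lambda_{\alpha,\beta}=\min(\alpha,\beta)\,(r+1-\max(\alpha,\beta))$. For $\alpha=0,1,\dots,r+1$ and $n\in\mathbb Z$ let $$\mathcal D_{\alpha,n}=v^{-\frac{\Lambda_{\alpha,\alpha}}2 n-\sum_{\beta=1}^r\Lambda_{\alpha,\beta}}\sum_{|I|=\alpha}(z_I)^n\,a_I({\mathbf z})\,D_I$$ (so that $\mathcal D_{0,n}=\mathcal D_{r+1,n}=1$).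 Fix an ordering $z_{\sigma(1)},\dots,z_{\sigma(r+1)}$ of the variables, and give $D_I$ the degree $d(I)=(d_1,\dots,d_r)\in\mathbb Z^r$ for which $D_I(z_{\sigma(1)}\cdots z_{\sigma(i)})=v^{d_i}z_{\sigma(1)}\cdots z_{\sigma(i)}$ formally, that is, $d_i=i\,|I|-(r+1)\,\#\{l\le i:\sigma(l)\in I\}$. For the product order on $\mathbb Z^r$, the set $\{\sigma(1),\dots,\sigma(\alpha)\}$ has the least degree among the sets $I$ of size $\alpha$. Regard $\mathcal D_{\alpha,n}$ as an element of the ring of formal series $\sum_{d\in\mathbb Z^r}A_d$ of $k$-linear operators $A_d$ on $K$ whose set of degrees $\{d:A_d\ne0\}$ is partially well-ordered, the product being composition, with degrees added. Then every $\mathcal D_{\alpha,n}$ has a (unique) two-sided inverse $\mathcal D_{\alpha,n}^{-1}$ in this ring. Define $$\mathcal Y_{2\alpha-1}(n)=\mathcal D_{\alpha-1,n}\,\mathcal D_{\alpha,n}^{-1}\,\mathcal D_{\alpha-1,n+1}^{-1}\,\mathcal D_{\alpha,n+1}\quad(1\le\alpha\le r+1),$$ $$\mathcal Y_{2\alpha}(n)=-\,\mathcal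 D_{\alpha-1,n}\,\mathcal D_{\alpha,n}^{-1}\,\mathcal D_{\alpha,n+1}^{-1}\,\mathcal D_{\alpha+1,n+1}\quad(1\le\alpha\le r),$$ and define the conserved quantities of the dual quantum $Q$-system by $$\mathcal C_m=\sum\mathcal Y_{i_1}(n)\,\mathcal Y_{i_2}(n)\cdots\mathcal Y_{i_m}(n),$$ where the sum is over $1\le i_1<\dots<i_m\le 2r+1$ with $i_\ell<i_{\ell+1}-1$ if $i_\ell$ is odd and $i_\ell<i_{\ell+1}-2$ if $i_\ell$ is even. Then for all $m=0,1,\dots,r+1$ and every $n\in\mathbb Z$, $\mathcal C_m$ is the operator, without shifts, of multiplication of functions of ${\mathbf z}$ by $v^{\frac{mr}2}e_m({\mathbf z})$: $$\mathcal C_m=v^{\frac{mr}{2}}\sum_{1\le i_1<i_2<\cdots<i_m\le r+1}z_{i_1}z_{i_2}\cdots z_{i_m}=v^{\frac{mr}{2}}\,e_m({\mathbf z}).$$ -/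

import Mathlib

noncomputable section

namespace DualQSystem

/-- The field of rational functions in `z₁, …, z_{r+1}` on the torus `z₁ z₂ ⋯ z_{r+1} = 1`,
written in the free coordinates `z₁, …, z_r`. -/
abbrev RatFun (r : ℕ) (k : Type*) [Field k] : Type _ := FractionRing (MvPolynomial (Fin r) k)

/-- The coordinate functions `z₁, …, z_{r+1}`, with `z_{r+1} = (z₁ ⋯ z_r)⁻¹`. -/
def z (r : ℕ) (k : Type*) [Field k] : Fin (r + 1) → RatFun r k :=
  Fin.snoc (α := fun _ => RatFun r k)
    (fun i => algebraMap (MvPolynomial (Fin r) k) (RatFun r k) (MvPolynomial.X i))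
    (∏ i : Fin r, algebraMap (MvPolynomial (Fin r) k) (RatFun r k) (MvPolynomial.X i))⁻¹

section Shifts

variable {r : ℕ} {k : Type*} [Field k]

/-- The substitution `z_j ↦ c_j z_j` (`1 ≤ j ≤ r`) on polynomials. -/
def polyDilation (c : Fin r → kˣ) : MvPolynomial (Fin r) k ≃ₐ[k] MvPolynomial (Fin r) k :=
  AlgEquiv.ofAlgHom
    (MvPolynomial.aeval fun j => MvPolynomial.C (c j : k) * MvPolynomial.X j)
    (MvPolynomial.aeval fun j => MvPolynomial.C ((c j)⁻¹ : k) * MvPolynomial.X j)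
    (by
      ext j : 1
      simp only [AlgHom.comp_apply, MvPolynomial.aeval_X, map_mul, MvPolynomial.aeval_C,
        MvPolynomial.algebraMap_eq, AlgHom.id_apply]
      rw [← mul_assoc, ← MvPolynomial.C_mul]
      simp)
    (by
      ext j : 1
      simp only [AlgHom.comp_apply, MvPolynomial.aeval_X, map_mul, MvPolynomial.aeval_C,
        MvPolynomial.algebraMap_eq, AlgHom.id_apply]
      rw [← mul_assoc, ← MvPolynomial.C_mul]
      simp)

/-- The substitution `z_j ↦ c_j z_j` (`1 ≤ j ≤ r`) on rational functions. -/
def dilation (c : Fin r → kˣ) : RatFun r k ≃ₐ[k] RatFun r k :=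
  IsFractionRing.algEquivOfAlgEquiv (polyDilation c)

/-- `q = v^{-(r+1)}`, where `v = u²`. -/
def qOf (r : ℕ) (u : kˣ) : kˣ := ((u ^ 2) ^ (r + 1))⁻¹

/-- The factor by which `D_i` multiplies `z_j`: it is `v` if `j ≠ i` and `q v` if `j = i`. -/
def shiftFactor (u : kˣ) (i j : Fin (r + 1)) : kˣ := u ^ 2 * if j = i then qOf r u else 1

/-- `D_I = ∏_{i ∈ I} D_i`, where `(D_i f)(z₁, …, z_{r+1}) = f (v z₁, …, q v z_i, …, v z_{r+1})`. -/
def shift (u : kˣ) (I : Finset (Fin (r + 1))) : RatFun r k ≃ₐ[k] RatFun r k :=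
  dilation fun j : Fin r => ∏ i ∈ I, shiftFactor u i j.castSucc

lemma dilation_X (c : Fin r → kˣ) (j : Fin r) :
    dilation c (algebraMap (MvPolynomial (Fin r) k) (RatFun r k) (MvPolynomial.X j)) =
      algebraMap k (RatFun r k) (c j) *
        algebraMap (MvPolynomial (Fin r) k) (RatFun r k) (MvPolynomial.X j) := by
  simp [dilation, polyDilation, IsScalarTower.algebraMap_apply k (MvPolynomial (Fin r) k)
    (RatFun r k), MvPolynomial.algebraMap_eq]

lemma prod_shiftFactor (u : kˣ) (i : Fin (r + 1)) : ∏ j, shiftFactor u i j = 1 := by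
  simp only [shiftFactor, Finset.prod_mul_distrib, Finset.prod_const, Finset.card_univ,
    Fintype.card_fin, Finset.prod_ite_eq', Finset.mem_univ, if_true, qOf, mul_inv_cancel]

/-- `D_I` acts on all the coordinates, the last one included, as it should. -/
lemma shift_z (u : kˣ) (I : Finset (Fin (r + 1))) (j : Fin (r + 1)) :
    shift u I (z r k j) =
      algebraMap k (RatFun r k) (∏ i ∈ I, shiftFactor u i j : kˣ) * z r k j := by
  refine Fin.lastCases ?_ (fun j => ?_) j
  · have h : (∏ i ∈ I, shiftFactor u i (Fin.last r)) =
        (∏ j : Fin r, ∏ i ∈ I, shiftFactor u i j.castSucc)⁻¹ := by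
      rw [eq_inv_iff_mul_eq_one, mul_comm, Finset.prod_comm, ← Finset.prod_mul_distrib]
      refine Finset.prod_eq_one fun i _ => ?_
      rw [← Fin.prod_univ_castSucc, prod_shiftFactor]
    rw [h]
    simp only [z, Fin.snoc_last, shift, map_inv₀, map_prod, dilation_X,
      Finset.prod_mul_distrib, mul_inv, Units.val_inv_eq_inv_val, Units.coe_prod]
  · simp only [z, Fin.snoc_castSucc, shift, dilation_X]

end Shifts

/-- Formal difference operators: formal series `∑_d A_d` of operators `A_d` on functions of `z`,
where `d` records by which powers of `v` the arguments are shifted (see `shiftDegree`), and the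
set of `d` with `A_d ≠ 0` is partially well-ordered for the product order of `ℤ^r`. The product
is `(∑_d A_d) (∑_e B_e) = ∑_f (∑_{d + e = f} A_d ∘ B_e)`. -/
abbrev FormalOp (r : ℕ) (k : Type*) [Field k] : Type _ :=
  HahnSeries (Fin r → ℤ) (Module.End k (RatFun r k))

section Operators

variable {r : ℕ} {k : Type*} [Field k]

/-- The operator of multiplication by the function `f`, without shift. -/
def mulOp (f : RatFun r k) : FormalOp r k := HahnSeries.C (LinearMap.mulLeft k f)

/-- The degree of `D_I`, for the ordering `z_{σ 1}, …, z_{σ (r+1)}` of the variables: its `i`-th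
entry `d_i` is the exponent in `D_I (z_{σ 1} ⋯ z_{σ i}) = v^{d_i} z_{σ 1} ⋯ z_{σ i}`.
Among the `I` of given size `α`, it is least for `I = {σ 1, …, σ α}`. -/
def shiftDegree (σ : Equiv.Perm (Fin (r + 1))) (I : Finset (Fin (r + 1))) : Fin r → ℤ := fun i =>
  ((i : ℤ) + 1) * I.card - ((r : ℤ) + 1) * (Finset.univ.filter fun l => l ≤ i.castSucc ∧ σ l ∈ I).card

/-- `Λ_{α,β} = min(α,β) (r + 1 - max(α,β))`. -/
def Lam (r a b : ℕ) : ℤ := (min a b : ℤ) * ((r : ℤ) + 1 - (max a b : ℤ))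

/-- `a_I(z) = ∏_{i ∈ I, j ∉ I} z_i / (z_i - z_j)`. -/
def aCoeff (k : Type*) [Field k] (I : Finset (Fin (r + 1))) : RatFun r k :=
  ∏ i ∈ I, ∏ j ∈ Iᶜ, z r k i / (z r k i - z r k j)

/-- `𝒟_{α,n} = v^{-Λ_{α,α} n / 2 - ∑_β Λ_{α,β}} ∑_{|I| = α} (z_I)^n a_I(z) D_I`, `v = u²`. -/
def Dop (u : kˣ) (σ : Equiv.Perm (Fin (r + 1))) (a : ℕ) (n : ℤ) : FormalOp r k :=
  ((u ^ (-(Lam r a a * n) - 2 * ∑ b ∈ Finset.Icc 1 r, Lam r a b) : kˣ) : k) •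
    ∑ I ∈ Finset.powersetCard a (Finset.univ : Finset (Fin (r + 1))),
      HahnSeries.single (shiftDegree σ I)
        (LinearMap.mulLeft k ((∏ i ∈ I, z r k i) ^ n * aCoeff k I) ∘ₗ (shift u I).toLinearMap)

/-- `𝒴_{2α-1}(n) = 𝒟_{α-1,n} 𝒟_{α,n}⁻¹ 𝒟_{α-1,n+1}⁻¹ 𝒟_{α,n+1}`. -/
def Yodd (u : kˣ) (σ : Equiv.Perm (Fin (r + 1))) (n : ℤ) (a : ℕ) : FormalOp r k :=
  Dop u σ (a - 1) n * Ring.inverse (Dop u σ a n) *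
    Ring.inverse (Dop u σ (a - 1) (n + 1)) * Dop u σ a (n + 1)

/-- `𝒴_{2α}(n) = - 𝒟_{α-1,n} 𝒟_{α,n}⁻¹ 𝒟_{α,n+1}⁻¹ 𝒟_{α+1,n+1}`. -/
def Yeven (u : kˣ) (σ : Equiv.Perm (Fin (r + 1))) (n : ℤ) (a : ℕ) : FormalOp r k :=
  -(Dop u σ (a - 1) n * Ring.inverse (Dop u σ a n) *
    Ring.inverse (Dop u σ a (n + 1)) * Dop u σ (a + 1) (n + 1))

/-- The weights `𝒴_i(n)`, for `1 ≤ i ≤ 2r+1`. -/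
def Y (u : kˣ) (σ : Equiv.Perm (Fin (r + 1))) (n : ℤ) (i : ℕ) : FormalOp r k :=
  if Even i then Yeven u σ n (i / 2) else Yodd u σ n ((i + 1) / 2)

/-- The hard particle configurations `1 ≤ i₁ < ⋯ < i_m ≤ 2r+1`: an odd `i_ℓ` satisfies
`i_ℓ < i_{ℓ+1} - 1` and an even `i_ℓ` satisfies `i_ℓ < i_{ℓ+1} - 2`. -/
def hardParticle (r m : ℕ) : Finset (Finset ℕ) :=
  {S ∈ Finset.powersetCard m (Finset.Icc 1 (2 * r + 1)) |
    ∀ i ∈ S, ∀ j ∈ S, i < j → (Odd i → i + 1 < j) ∧ (Even i → i + 2 < j)}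

/-- `𝒞_m = ∑ 𝒴_{i₁}(n) 𝒴_{i₂}(n) ⋯ 𝒴_{i_m}(n)` over the hard particle configurations
`i₁ < i₂ < ⋯ < i_m`. -/
def Cons (u : kˣ) (σ : Equiv.Perm (Fin (r + 1))) (n : ℤ) (m : ℕ) : FormalOp r k :=
  ∑ S ∈ hardParticle r m, ((S.sort (· ≤ ·)).map (Y u σ n)).prod

end Operators

end DualQSystem

end

/-!
Write `N = r + 1` and let `X` be a central variable. The conserved quantities are the coefficients
of the generating polynomial `h_N`, where `h_a = ∑_S X^|S| 𝒴_{i₁} ⋯ 𝒴_{i_m}` over the hard particle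
configurations `S = {i₁ < ⋯ < i_m}` in `[1, 2a-1]`. Sorting the configurations by their largest
elements gives (`hardPoly_add_three`)
`h_{a+1} = h_a (1 + X 𝒴_{2a+1}) + X h_{a-1} 𝒴_{2a}`.

The key is a closed formula for all `h_a` (`ShiftRep.hardPoly_mul_C_D`): `h_a 𝒟_{a,n} = E_{a,n}`,
where `E_{a,n}` is obtained from `𝒟_{a,n}` by inserting the factor `∏_{i ∈ I} (1 + u^r X z_i)` to
the left of each `D_I`. For `a = N` the only set is the full one, the current is `1`, and the
formula reads `h_N = ∏_i (1 + u^r X z_i)`, which is the theorem.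

The closed formula is proved by induction on `a`. The induction step (`ShiftRep.recursion_mul_C_D`)
is an elimination from two bilinear identities, `ShiftRep.E_mul_D_sub` and
`ShiftRep.E_succ_mul_D_sub`:
`E_{a,n} 𝒟_{a,n} - E_{a-1,n} 𝒟_{a+1,n} = v^{Λ_{a,a}} E_{a,n-1} 𝒟_{a,n+1}`,
`E_{a+1,n} 𝒟_{a,n} - E_{a,n} 𝒟_{a+1,n} = X v^{Λ_{a+1,a+1}} E_{a,n-1} 𝒟_{a+1,n+1}`.
It also uses that neighbouring currents commute up to powers of `v`. All but one of these
commutation relations are read off from the lowest and highest coefficients in `X` of the two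
identities; the remaining one is `ShiftRep.C_D_succ_mul_C_D`.

A bilinear identity is checked coefficient by coefficient. The shift `D_I D_J` depends only on
`A = I ∩ J` and on the symmetric difference `B`, so that the sum over the splittings of `B` into
`S = I \ J` and `T = J \ I` has to vanish. This is a subset-sum identity with weights
`∏_{i ∈ S, j ∈ T} 1 / ((z_i - z_j)(z_j - q z_i))`. For independent variables it is shown by
induction on `|B|` (`sum_splitTerm_eq_zero`): as a function of one variable `z_b`, and with its
denominators cleared, the sum is a polynomial of degree less than `3 (|B| - 1)` that vanishes at the
points `z_k`, `q z_k` and `z_k / q` for `k ≠ b`. The identity then specializes to all points where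
its denominators do not vanish (`sum_specialize_mul_pairWeight_eq_zero`), which allows `v` to be a
root of unity and `k` to have any characteristic.

Invertibility of the currents is that of formal series with a least degree and an invertible leading
coefficient (`HahnSeries.isUnit_sum_single`); the least degree is that of the set of the first `a`
variables (`shiftDegree_lt`).
-/

open Polynomial Finset

namespace DualQSystem

/-! ### Sums over the splittings of a finite set -/

section SubsetSums

variable {ι : Type*}

/-- The weight `∏_{i ∈ S, j ∈ T} 1 / ((x_i - x_j)(x_j - q x_i))` of a splitting `(S, T)`. For a
product of two currents this is the part of `a_I · D_I(a_J)` that depends on how the symmetric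
difference of `I` and `J` is split into `S = I \ J` and `T = J \ I`. -/
noncomputable def pairWeight {F : Type*} [Field F] (q : F) (x : ι → F) (S T : Finset ι) : F :=
  ∏ i ∈ S, ∏ j ∈ T, ((x i - x j) * (x j - q * x i))⁻¹

/-- A function of splittings `(S, T)` that is a combination of products
`∏_{i ∈ S} g_l(x_i) ∏_{j ∈ T} h_l(x_j)`, with coefficients `c_l(|S|, |T|)` that depend only on the
two sizes. -/
noncomputable def splitTerm {F : Type*} [CommRing F] {n : ℕ} (c : Fin n → ℕ → ℕ → F)
    (g h : Fin n → F[X]) (x : ι → F) (S T : Finset ι) : F :=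
  ∑ l, c l #S #T * ((∏ i ∈ S, (g l).eval (x i)) * ∏ j ∈ T, (h l).eval (x j))

lemma pairWeight_insert_left [DecidableEq ι] {F : Type*} [Field F] (q : F)
    (x : ι → F) {S T : Finset ι} {b : ι} (hb : b ∉ S) : pairWeight q x (insert b S) T =
      (∏ j ∈ T, ((x b - x j) * (x j - q * x b))⁻¹) * pairWeight q x S T := by
  simp [pairWeight, prod_insert hb]

lemma pairWeight_insert_right [DecidableEq ι] {F : Type*} [Field F] (q : F)
    (x : ι → F) {S T : Finset ι} {b : ι} (hb : b ∉ T) : pairWeight q x S (insert b T) =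
      (∏ i ∈ S, ((x i - x b) * (x b - q * x i))⁻¹) * pairWeight q x S T := by
  simp only [pairWeight, prod_insert hb, prod_mul_distrib]

/-- The sum of `splitTerm * pairWeight` over the splittings of `B ∪ {b}`, as a polynomial in the
value `y = x b`, after multiplication by `∏_{k ∈ B} (y - x_k)(y - q x_k)(x_k - q y)`. For a subset
`S` of `B`, the two summands are the contributions of `(S, B \ S ∪ {b})` and
`(S ∪ {b}, B \ S)`. -/
noncomputable def clearedSum [DecidableEq ι] {F : Type*} [Field F] {n : ℕ}
    (q : F) (c : Fin n → ℕ → ℕ → F) (g h : Fin n → F[X]) (x : ι → F) (B : Finset ι) : F[X] :=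
  ∑ S ∈ B.powerset, C (pairWeight q x S (B \ S)) *
    ((∑ l, C (c l #S (#(B \ S) + 1) * ((∏ i ∈ S, (g l).eval (x i)) *
          ∏ j ∈ B \ S, (h l).eval (x j))) * h l) *
        ((∏ i ∈ S, (C q * X - C (x i))) *
          ∏ j ∈ B \ S, ((X - C (x j)) * (X - C (q * x j)) * (C (x j) - C q * X))) +
      (∑ l, C (c l (#S + 1) #(B \ S) * ((∏ i ∈ S, (g l).eval (x i)) *
          ∏ j ∈ B \ S, (h l).eval (x j))) * g l) *
        ((∏ j ∈ B \ S, (X - C (q * x j))) *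
          ∏ i ∈ S, ((X - C (x i)) * (X - C (q * x i)) * (C (x i) - C q * X))))

lemma natDegree_prod_le_mul_card {F : Type*} [Field F] (d : ℕ) (p : ι → F[X]) (S : Finset ι)
    (hp : ∀ j ∈ S, (p j).natDegree ≤ d) : (∏ j ∈ S, p j).natDegree ≤ d * #S := by
  refine (natDegree_prod_le _ _).trans ((sum_le_card_nsmul _ _ d hp).trans ?_)
  simp [mul_comm]

lemma natDegree_prod_cubic_le {F : Type*} [Field F] (q : F) (x : ι → F) (S : Finset ι) :
    (∏ j ∈ S, ((X - C (x j)) * (X - C (q * x j)) * (C (x j) - C q * X))).natDegree ≤ 3 * #S := by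
  refine natDegree_prod_le_mul_card 3 _ _ fun j _ => ?_
  compute_degree

/-- The degree stays below the number `3 |B|` of zeros found below. The hypotheses bound the degrees
of `g_l` and `h_l` only for the sizes where the coefficient `c_l` does not vanish. -/
lemma natDegree_clearedSum_lt [DecidableEq ι] {F : Type*} [Field F] {n : ℕ} (q : F)
    (c : Fin n → ℕ → ℕ → F) (g h : Fin n → F[X]) (x : ι → F) (B : Finset ι) (hB : 0 < #B)
    (hg : ∀ l s t, s + t = #B → c l (s + 1) t ≠ 0 → (g l).natDegree < 2 * t)
    (hh : ∀ l s t, s + t = #B → c l s (t + 1) ≠ 0 → (h l).natDegree < 2 * s) :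
    (clearedSum q c g h x B).natDegree < 3 * #B := by
  have hsum : ∀ (d : ℕ) (a : Fin n → F) (p : Fin n → F[X]),
      (∀ l, a l ≠ 0 → (p l).natDegree ≤ d) → (∑ l, C (a l) * p l).natDegree ≤ d := by
    intro d a p H
    refine natDegree_sum_le_of_forall_le _ _ fun l _ => ?_
    by_cases hl : a l = 0
    · simp [hl]
    · exact (natDegree_C_mul_le _ _).trans (H l hl)
  refine Nat.lt_of_le_pred (by omega) (natDegree_sum_le_of_forall_le _ _ fun S hS => ?_)
  have hcard : #S + #(B \ S) = #B := by
    rw [card_sdiff_of_subset (mem_powerset.1 hS)]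
    have := card_le_card (mem_powerset.1 hS)
    omega
  refine (natDegree_C_mul_le _ _).trans (natDegree_add_le_of_degree_le ?_ ?_)
  · by_cases hz : ∀ l, c l #S (#(B \ S) + 1) = 0
    · simp [hz]
    push Not at hz
    obtain ⟨l0, hl0⟩ := hz
    have hpos := hh l0 _ _ hcard hl0
    refine natDegree_mul_le.trans ?_
    have h1 := hsum (2 * #S - 1) (fun l => c l #S (#(B \ S) + 1) * ((∏ i ∈ S, (g l).eval (x i)) *
          ∏ j ∈ B \ S, (h l).eval (x j))) h
        (fun l hl => Nat.le_pred_of_lt (hh l _ _ hcard (left_ne_zero_of_mul hl)))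
    have h2 : (∏ i ∈ S, (C q * X - C (x i))).natDegree ≤ 1 * #S := by
      refine natDegree_prod_le_mul_card 1 _ _ fun j _ => ?_
      compute_degree
    have h3 := natDegree_prod_cubic_le q x (B \ S)
    have h4 := natDegree_mul_le (p := ∏ i ∈ S, (C q * X - C (x i)))
      (q := ∏ j ∈ B \ S, ((X - C (x j)) * (X - C (q * x j)) * (C (x j) - C q * X)))
    simp only [Nat.pred_eq_sub_one]
    omega
  · by_cases hz : ∀ l, c l (#S + 1) #(B \ S) = 0
    · simp [hz]
    push Not at hz
    obtain ⟨l0, hl0⟩ := hz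
    have hpos := hg l0 _ _ hcard hl0
    refine natDegree_mul_le.trans ?_
    have h1 := hsum (2 * #(B \ S) - 1) (fun l => c l (#S + 1) #(B \ S) *
          ((∏ i ∈ S, (g l).eval (x i)) * ∏ j ∈ B \ S, (h l).eval (x j))) g
        (fun l hl => Nat.le_pred_of_lt (hg l _ _ hcard (left_ne_zero_of_mul hl)))
    have h2 : (∏ j ∈ B \ S, (X - C (q * x j))).natDegree ≤ 1 * #(B \ S) := by
      refine natDegree_prod_le_mul_card 1 _ _ fun j _ => ?_
      compute_degree
    have h3 := natDegree_prod_cubic_le q x S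
    have h4 := natDegree_mul_le (p := ∏ j ∈ B \ S, (X - C (q * x j)))
      (q := ∏ i ∈ S, ((X - C (x i)) * (X - C (q * x i)) * (C (x i) - C q * X)))
    simp only [Nat.pred_eq_sub_one]
    omega

lemma eval_clearedSum [DecidableEq ι] {F : Type*} [Field F] {n : ℕ} (q : F) (c : Fin n → ℕ → ℕ → F)
    (g h : Fin n → F[X]) (x : ι → F) (B : Finset ι) (y : F) :
    (clearedSum q c g h x B).eval y =
      ∑ S ∈ B.powerset, pairWeight q x S (B \ S) *
    ((∑ l, c l #S (#(B \ S) + 1) * ((∏ i ∈ S, (g l).eval (x i)) *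
          ∏ j ∈ B \ S, (h l).eval (x j)) * (h l).eval y) *
        ((∏ i ∈ S, (q * y - x i)) *
          ∏ j ∈ B \ S, ((y - x j) * (y - q * x j) * (x j - q * y))) +
      (∑ l, c l (#S + 1) #(B \ S) * ((∏ i ∈ S, (g l).eval (x i)) *
          ∏ j ∈ B \ S, (h l).eval (x j)) * (g l).eval y) *
        ((∏ j ∈ B \ S, (y - q * x j)) *
          ∏ i ∈ S, ((y - x i) * (y - q * x i) * (x i - q * y)))) := by
  simp [clearedSum, eval_finsetSum, eval_prod]

end SubsetSums

/-! ### Vanishing of the sums over splittings -/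

section SubsetSums

variable {ι : Type*}

section
variable [DecidableEq ι] {F : Type*} [Field F] {n : ℕ} (q : F) (c : Fin n → ℕ → ℕ → F)
    (g h : Fin n → F[X]) (x : ι → F) (B : Finset ι)

lemma insert_sdiff_insert_of_notMem {k : ι} {R : Finset ι} (hk : k ∉ B) :
    insert k B \ insert k R = B \ R := by
  ext i
  simp only [mem_sdiff, mem_insert]
  by_cases hi : i = k
  · simp [hi, hk]
  · simp [hi]

/-- At `y = x_k` the only terms without a vanishing factor have `k` and `b` on different sides, and
exchanging `k` and `b` changes their sign. -/
lemma eval_clearedSum_self {k : ι} (hk : k ∉ B) (hx : ∀ i ∈ B, x i ≠ x k)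
    (hqx : ∀ i ∈ B, x k ≠ q * x i) (hqx' : ∀ i ∈ B, x i ≠ q * x k) :
    (clearedSum q c g h x (insert k B)).eval (x k) = 0 := by
  rw [eval_clearedSum, sum_powerset_insert hk, ← sum_add_distrib]
  refine sum_eq_zero fun R hR => ?_
  have hRB := mem_powerset.1 hR
  have hkR : k ∉ R := fun h => hk (hRB h)
  have hkT : k ∉ B \ R := fun h => hk (sdiff_subset h)
  rw [insert_sdiff_insert_of_notMem B hk, insert_sdiff_of_notMem B hkR]
  simp only [prod_insert hkR, prod_insert hkT, card_insert_of_notMem hkR,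
    card_insert_of_notMem hkT, pairWeight_insert_left q x hkR, pairWeight_insert_right q x hkT,
    sub_self, zero_mul, mul_zero, zero_add, add_zero]
  set T := B \ R with hT
  have e1 : (∏ i ∈ R, ((x i - x k) * (x k - q * x i))⁻¹) *
      ∏ i ∈ R, ((x k - x i) * (x k - q * x i) * (x i - q * x k)) =
      ∏ i ∈ R, (q * x k - x i) := by
    rw [← prod_mul_distrib]
    refine prod_congr rfl fun i hi => ?_
    have h1 := sub_ne_zero.2 (hx i (hRB hi))
    have h2 := sub_ne_zero.2 (hqx i (hRB hi))
    rw [inv_mul_eq_iff_eq_mul₀ (mul_ne_zero h1 h2)]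
    ring
  have e2 : (∏ j ∈ T, ((x k - x j) * (x j - q * x k))⁻¹) *
      ∏ j ∈ T, ((x k - x j) * (x k - q * x j) * (x j - q * x k)) =
      ∏ j ∈ T, (x k - q * x j) := by
    rw [← prod_mul_distrib]
    refine prod_congr rfl fun j hj => ?_
    have h1 := sub_ne_zero.2 (hx j (sdiff_subset hj)).symm
    have h2 := sub_ne_zero.2 (hqx' j (sdiff_subset hj))
    rw [inv_mul_eq_iff_eq_mul₀ (mul_ne_zero h1 h2)]
    ring
  -- Exchanging the roles of `k` and `b` does not change the term of the splitting.
  have e3 : (∑ l, c l (#R + 1) (#T + 1) * (((g l).eval (x k) * ∏ i ∈ R, (g l).eval (x i)) *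
      ∏ j ∈ T, (h l).eval (x j)) * (h l).eval (x k)) =
      ∑ l, c l (#R + 1) (#T + 1) * ((∏ i ∈ R, (g l).eval (x i)) * ((h l).eval (x k) *
      ∏ j ∈ T, (h l).eval (x j))) * (g l).eval (x k) :=
    sum_congr rfl fun l _ => by ring
  rw [e3]
  set f := ∑ l, c l (#R + 1) (#T + 1) * ((∏ i ∈ R, (g l).eval (x i)) * ((h l).eval (x k) *
      ∏ j ∈ T, (h l).eval (x j))) * (g l).eval (x k)
  linear_combination (pairWeight q x R T * f * (x k - q * x k) * ∏ j ∈ T, (x k - q * x j)) * e1 +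
    (pairWeight q x R T * f * (q * x k - x k) * ∏ j ∈ R, (q * x k - x j)) * e2

/-- At `y = q x_k` only the splittings with `k ∈ S` and `b ∈ T` survive; by `ha` their sum is a
multiple of the sum for the set without `k`. -/
lemma eval_clearedSum_mul {k : ι} (hk : k ∉ B) (hx : ∀ i ∈ B, x i ≠ x k)
    (hqx' : ∀ i ∈ B, x i ≠ q * x k) (a : F)
    (ha : ∀ l s t, s + t = #B → c l (s + 1) (t + 1) * (g l).eval (x k) * (h l).eval (q * x k) *
      q ^ t = a * c l s t)
    (h0 : ∑ S ∈ B.powerset, splitTerm c g h x S (B \ S) * pairWeight q x S (B \ S) = 0) :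
    (clearedSum q c g h x (insert k B)).eval (q * x k) = 0 := by
  rw [eval_clearedSum, sum_powerset_insert hk, ← sum_add_distrib,
    ← mul_zero (a * (q * (q * x k) - x k) * ∏ i ∈ B, (q * (q * x k) - x i)), ← h0, mul_sum]
  refine sum_congr rfl fun R hR => ?_
  have hRB := mem_powerset.1 hR
  have hkR : k ∉ R := fun h => hk (hRB h)
  have hkT : k ∉ B \ R := fun h => hk (sdiff_subset h)
  rw [insert_sdiff_insert_of_notMem B hk, insert_sdiff_of_notMem B hkR]
  have hcard : #R + #(B \ R) = #B := by
    rw [add_comm, card_sdiff_add_card_eq_card hRB]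
  simp only [prod_insert hkR, prod_insert hkT, card_insert_of_notMem hkR,
    card_insert_of_notMem hkT, pairWeight_insert_left q x hkR, pairWeight_insert_right q x hkT,
    sub_self, zero_mul, mul_zero, zero_add, add_zero]
  rw [← prod_sdiff hRB]
  set T := B \ R with hT
  have e2 : (∏ j ∈ T, ((x k - x j) * (x j - q * x k))⁻¹) *
      ∏ j ∈ T, ((q * x k - x j) * (q * x k - q * x j) * (x j - q * (q * x k))) =
      q ^ #T * ∏ j ∈ T, (q * (q * x k) - x j) := by
    rw [← prod_mul_distrib, ← prod_const, ← prod_mul_distrib]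
    refine prod_congr rfl fun j hj => ?_
    have h1 := sub_ne_zero.2 (hx j (sdiff_subset hj)).symm
    have h2 := sub_ne_zero.2 (hqx' j (sdiff_subset hj))
    rw [inv_mul_eq_iff_eq_mul₀ (mul_ne_zero h1 h2)]
    ring
  have e3 : (∑ l, c l (#R + 1) (#T + 1) * (((g l).eval (x k) * ∏ i ∈ R, (g l).eval (x i)) *
      ∏ j ∈ T, (h l).eval (x j)) * (h l).eval (q * x k)) * q ^ #T =
      a * splitTerm c g h x R T := by
    rw [splitTerm, sum_mul, mul_sum]
    refine sum_congr rfl fun l _ => ?_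
    linear_combination ((∏ i ∈ R, (g l).eval (x i)) * ∏ j ∈ T, (h l).eval (x j)) *
      ha l #R #T hcard
  set f := ∑ l, c l (#R + 1) (#T + 1) * (((g l).eval (x k) * ∏ i ∈ R, (g l).eval (x i)) *
      ∏ j ∈ T, (h l).eval (x j)) * (h l).eval (q * x k)
  linear_combination (pairWeight q x R T * f * (q * (q * x k) - x k) *
      ∏ j ∈ R, (q * (q * x k) - x j)) * e2 +
    (pairWeight q x R T * (q * (q * x k) - x k) * (∏ j ∈ R, (q * (q * x k) - x j)) *
      ∏ j ∈ T, (q * (q * x k) - x j)) * e3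

/-- At `y = x_k / q` only the splittings with `k ∈ T` and `b ∈ S` survive; by `ha` their sum is a
multiple of the sum for the set without `k`. -/
lemma eval_clearedSum_div {k : ι} (hk : k ∉ B) (hq : q ≠ 0) (hx : ∀ i ∈ B, x i ≠ x k)
    (hqx : ∀ i ∈ B, x k ≠ q * x i) (y : F) (hy : x k = q * y) (a : F)
    (ha : ∀ l s t, s + t = #B → c l (s + 1) (t + 1) * (g l).eval y * (h l).eval (q * y) *
      q ^ t = a * c l s t)
    (h0 : ∑ S ∈ B.powerset, splitTerm c g h x S (B \ S) * pairWeight q x S (B \ S) = 0) :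
    (clearedSum q c g h x (insert k B)).eval y = 0 := by
  rw [eval_clearedSum, sum_powerset_insert hk, ← sum_add_distrib,
    ← mul_zero (a * (y - q * x k) * (q ^ #B)⁻¹ * ∏ i ∈ B, (y - q * x i)), ← h0, mul_sum]
  refine sum_congr rfl fun R hR => ?_
  have hRB := mem_powerset.1 hR
  have hkR : k ∉ R := fun h => hk (hRB h)
  have hkT : k ∉ B \ R := fun h => hk (sdiff_subset h)
  rw [insert_sdiff_insert_of_notMem B hk, insert_sdiff_of_notMem B hkR]
  have hcard : #R + #(B \ R) = #B := by
    rw [add_comm, card_sdiff_add_card_eq_card hRB]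
  have hz : x k - q * y = 0 := sub_eq_zero.2 hy
  have hz' : q * y - x k = 0 := sub_eq_zero.2 hy.symm
  simp only [prod_insert hkR, prod_insert hkT, card_insert_of_notMem hkR,
    card_insert_of_notMem hkT, pairWeight_insert_left q x hkR, pairWeight_insert_right q x hkT,
    hz, hz', zero_mul, mul_zero, zero_add, add_zero]
  rw [← prod_sdiff hRB, ← hcard]
  set T := B \ R with hT
  have e1 : (∏ i ∈ R, ((x i - x k) * (x k - q * x i))⁻¹) *
      ∏ i ∈ R, ((y - x i) * (y - q * x i) * (x i - q * y)) =
      (q ^ #R)⁻¹ * ∏ i ∈ R, (y - q * x i) := by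
    rw [← prod_mul_distrib, ← prod_const, ← prod_inv_distrib, ← prod_mul_distrib]
    refine prod_congr rfl fun i hi => ?_
    have h1 := sub_ne_zero.2 (hx i (hRB hi))
    have h2 := sub_ne_zero.2 (hqx i (hRB hi))
    rw [hy] at h1 h2 ⊢
    have h3 : y - x i ≠ 0 := fun h => h2 (by linear_combination q * h)
    have h4 : q * y - q * x i = q * (y - x i) := by ring
    rw [h4]
    field_simp
  have e3 : (∑ l, c l (#R + 1) (#T + 1) * ((∏ i ∈ R, (g l).eval (x i)) *
      ((h l).eval (x k) * ∏ j ∈ T, (h l).eval (x j))) * (g l).eval y) =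
      a * splitTerm c g h x R T * (q ^ #T)⁻¹ := by
    rw [eq_mul_inv_iff_mul_eq₀ (pow_ne_zero _ hq), splitTerm, sum_mul, mul_sum]
    refine sum_congr rfl fun l _ => ?_
    rw [hy]
    linear_combination ((∏ i ∈ R, (g l).eval (x i)) * ∏ j ∈ T, (h l).eval (x j)) *
      ha l #R #T hcard
  rw [e3, pow_add, mul_inv]
  linear_combination (pairWeight q x R T * a * splitTerm c g h x R T * (q ^ #T)⁻¹ *
    (y - q * x k) * ∏ j ∈ T, (y - q * x j)) * e1

/-- If the sum over splittings vanishes for the sets with one point less than `B`, then it vanishes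
for the sets with one point more: the cleared sum has the `3 |B|` distinct zeros `x_k`, `q x_k` and
`x_k / q`, which is more than its degree. -/
lemma sum_splitTerm_insert_eq_zero {b : ι} (hb : b ∉ B) (hB : 0 < #B)
    (hq : q ≠ 0) (hq1 : q ≠ 1) (hq2 : q ^ 2 ≠ 1)
    (hx0 : ∀ i ∈ B, x i ≠ 0)
    (hx : ∀ i ∈ insert b B, ∀ j ∈ insert b B, i ≠ j →
      x i ≠ x j ∧ x i ≠ q * x j ∧ x i ≠ q ^ 2 * x j)
    (hg : ∀ l s t, s + t = #B → c l (s + 1) t ≠ 0 → (g l).natDegree < 2 * t)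
    (hh : ∀ l s t, s + t = #B → c l s (t + 1) ≠ 0 → (h l).natDegree < 2 * s)
    (a : F → F)
    (ha : ∀ l s t y, s + t + 1 = #B → c l (s + 1) (t + 1) * (g l).eval y * (h l).eval (q * y) *
      q ^ t = a y * c l s t)
    (h0 : ∀ B' : Finset ι, B' ⊆ B → #B' + 1 = #B →
      ∑ S ∈ B'.powerset, splitTerm c g h x S (B' \ S) * pairWeight q x S (B' \ S) = 0) :
    ∑ S ∈ (insert b B).powerset,
      splitTerm c g h x S (insert b B \ S) * pairWeight q x S (insert b B \ S) = 0 := by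
  have hpoly : clearedSum q c g h x B = 0 := by
    -- The three families of zeros, indexed by `B × Fin 3`; genericity makes them distinct.
    refine eq_zero_of_natDegree_lt_card_of_eval_eq_zero _
      (f := fun p : B × Fin 3 => ![x p.1, q * x p.1, q⁻¹ * x p.1] p.2) ?_ ?_ ?_
    · have key : ∀ i ∈ B, ∀ j ∈ B, (x i = x j → i = j) ∧ (x i ≠ q * x j) ∧ (x i ≠ q ^ 2 * x j) := by
        intro i hi j hj
        by_cases hij : i = j
        · subst hij
          refine ⟨fun _ => rfl, fun h => hq1 ?_, fun h => hq2 ?_⟩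
          · exact mul_right_cancel₀ (hx0 i hi) (by rw [← h, one_mul])
          · exact mul_right_cancel₀ (hx0 i hi) (by rw [← h, one_mul])
        · obtain ⟨h1, h2, h3⟩ := hx i (mem_insert_of_mem hi) j (mem_insert_of_mem hj) hij
          exact ⟨fun h => absurd h h1, h2, h3⟩
      rintro ⟨⟨i, hi⟩, e⟩ ⟨⟨j, hj⟩, e'⟩ hij
      obtain ⟨h1, h2, h3⟩ := key i hi j hj
      obtain ⟨-, h2', h3'⟩ := key j hj i hi
      have e1 : ∀ y : F, y = q * (q⁻¹ * y) := fun y => by field_simp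
      have e2 : ∀ y : F, q * y = q ^ 2 * (q⁻¹ * y) := fun y => by field_simp
      fin_cases e <;> fin_cases e' <;> simp at hij ⊢
      · exact h1 hij
      · exact h2 hij
      · exact h2' (by rw [hij, ← e1])
      · exact h2' hij.symm
      · exact h1 (hij.resolve_right hq)
      · exact h3' (by rw [sq, mul_assoc, hij, ← e1])
      · exact h2 (by rw [← hij, ← e1])
      · exact h3 (by rw [sq, mul_assoc, ← hij, ← e1])
      · exact h1 (hij.resolve_right hq)
    · rintro ⟨⟨k, hk⟩, e⟩
      obtain ⟨B', hkB', rfl⟩ : ∃ B', k ∉ B' ∧ insert k B' = B :=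
        ⟨B.erase k, by simp, insert_erase hk⟩
      have hcard : #(insert k B') = #B' + 1 := card_insert_of_notMem hkB'
      have hne : ∀ i ∈ B', i ≠ k := fun i hi h => hkB' (h ▸ hi)
      have hmem : ∀ i ∈ B', i ∈ insert b (insert k B') := fun i hi => by simp [hi]
      have hmemk : k ∈ insert b (insert k B') := by simp
      have h1 : ∀ i ∈ B', x i ≠ x k := fun i hi => (hx i (hmem i hi) k hmemk (hne i hi)).1
      have h2 : ∀ i ∈ B', x k ≠ q * x i := fun i hi =>
        (hx k hmemk i (hmem i hi) (hne i hi).symm).2.1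
      have h3 : ∀ i ∈ B', x i ≠ q * x k := fun i hi => (hx i (hmem i hi) k hmemk (hne i hi)).2.1
      have h4 := h0 B' (subset_insert _ _) hcard.symm
      fin_cases e
      · exact eval_clearedSum_self q c g h x B' hkB' h1 h2 h3
      · exact eval_clearedSum_mul q c g h x B' hkB' h1 h3 (a (x k))
          (fun l s t hst => ha l s t _ (by omega)) h4
      · exact eval_clearedSum_div q c g h x B' hkB' hq h1 h2 _ (by simp [hq]) (a _)
          (fun l s t hst => ha l s t _ (by omega)) h4
    · simpa [mul_comm] using natDegree_clearedSum_lt q c g h x B hB hg hh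
  -- The value of the cleared sum at `x b` is the sum itself times a nonzero denominator.
  have hev := congrArg (eval (x b)) hpoly
  rw [eval_clearedSum, eval_zero] at hev
  have hmem : ∀ i ∈ B, i ∈ insert b B := fun i hi => by simp [hi]
  have hmemb : b ∈ insert b B := by simp
  have hne : ∀ i ∈ B, i ≠ b := fun i hi h => hb (h ▸ hi)
  have n1 : ∀ i ∈ B, x b - x i ≠ 0 := fun i hi =>
    sub_ne_zero.2 (hx b hmemb i (hmem i hi) (hne i hi).symm).1
  have n1' : ∀ i ∈ B, x i - x b ≠ 0 := fun i hi =>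
    sub_ne_zero.2 (hx i (hmem i hi) b hmemb (hne i hi)).1
  have n2 : ∀ i ∈ B, x b - q * x i ≠ 0 := fun i hi =>
    sub_ne_zero.2 (hx b hmemb i (hmem i hi) (hne i hi).symm).2.1
  have n3 : ∀ i ∈ B, x i - q * x b ≠ 0 := fun i hi =>
    sub_ne_zero.2 (hx i (hmem i hi) b hmemb (hne i hi)).2.1
  have hden : ∏ i ∈ B, ((x b - x i) * (x b - q * x i) * (x i - q * x b)) ≠ 0 :=
    prod_ne_zero_iff.2 fun i hi => mul_ne_zero (mul_ne_zero (n1 i hi) (n2 i hi)) (n3 i hi)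
  refine (mul_eq_zero.1 (?_ : (∏ i ∈ B, ((x b - x i) * (x b - q * x i) * (x i - q * x b))) * _
    = 0)).resolve_left hden
  rw [← hev, sum_powerset_insert hb, ← sum_add_distrib, mul_sum]
  refine sum_congr rfl fun R hR => ?_
  have hRB := mem_powerset.1 hR
  have hkR : b ∉ R := fun h => hb (hRB h)
  have hkT : b ∉ B \ R := fun h => hb (sdiff_subset h)
  rw [insert_sdiff_insert_of_notMem B hb, insert_sdiff_of_notMem B hkR, ← prod_sdiff hRB]
  simp only [splitTerm, prod_insert hkR, prod_insert hkT, card_insert_of_notMem hkR,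
    card_insert_of_notMem hkT, pairWeight_insert_left q x hkR, pairWeight_insert_right q x hkT]
  set T := B \ R with hT
  have e1 : (∏ i ∈ R, ((x b - x i) * (x b - q * x i) * (x i - q * x b))) *
      (∏ i ∈ R, ((x i - x b) * (x b - q * x i))⁻¹) = ∏ i ∈ R, (q * x b - x i) := by
    rw [← prod_mul_distrib]
    refine prod_congr rfl fun i hi => ?_
    have h1 := n1' i (hRB hi)
    have h2 := n2 i (hRB hi)
    rw [mul_inv_eq_iff_eq_mul₀ (mul_ne_zero h1 h2)]
    ring
  have e2 : (∏ j ∈ T, ((x b - x j) * (x b - q * x j) * (x j - q * x b))) *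
      (∏ j ∈ T, ((x b - x j) * (x j - q * x b))⁻¹) = ∏ j ∈ T, (x b - q * x j) := by
    rw [← prod_mul_distrib]
    refine prod_congr rfl fun i hi => ?_
    have h1 := n1 i (sdiff_subset hi)
    have h2 := n3 i (sdiff_subset hi)
    rw [mul_inv_eq_iff_eq_mul₀ (mul_ne_zero h1 h2)]
    ring
  have e3 : (∑ l, c l #R (#T + 1) * ((∏ i ∈ R, (g l).eval (x i)) *
      ((h l).eval (x b) * ∏ j ∈ T, (h l).eval (x j)))) =
      ∑ l, c l #R (#T + 1) * ((∏ i ∈ R, (g l).eval (x i)) *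
       ∏ j ∈ T, (h l).eval (x j)) * (h l).eval (x b) :=
    sum_congr rfl fun l _ => by ring
  have e4 : (∑ l, c l (#R + 1) #T * (((g l).eval (x b) * ∏ i ∈ R, (g l).eval (x i)) *
      ∏ j ∈ T, (h l).eval (x j))) =
      ∑ l, c l (#R + 1) #T * ((∏ i ∈ R, (g l).eval (x i)) *
       ∏ j ∈ T, (h l).eval (x j)) * (g l).eval (x b) :=
    sum_congr rfl fun l _ => by ring
  rw [e3, e4, ← e1, ← e2]
  ring

end

end SubsetSums
section SubsetSums

variable {ι : Type*} [DecidableEq ι] {F : Type*} [Field F]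

/-- Genericity of `q` and of the points `x i`: for each `b`, the points `x k`, `q * x k` and
`q⁻¹ * x k` (`k ≠ b`) are pairwise distinct, and `x b` is none of them. -/
structure IsGeneric {ι F : Type*} [Field F] (q : F) (x : ι → F) : Prop where
  ne_zero : q ≠ 0
  ne_one : q ≠ 1
  sq_ne_one : q ^ 2 ≠ 1
  coord_ne_zero : ∀ i, x i ≠ 0
  separated : ∀ i j, i ≠ j → x i ≠ x j ∧ x i ≠ q * x j ∧ x i ≠ q ^ 2 * x j

/-- A criterion for the vanishing of a sum over splittings at a generic point: the degree bounds
`hg`, `hh`, the compatibility `ha` of the residues at `x_b = q x_k` and `x_b = x_k / q` with the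
terms for two points less, in which the factor `a` must not depend on `l`, and the sets of size at
most `m₀`. -/
lemma sum_splitTerm_eq_zero {n : ℕ} (q : F) (c : Fin n → ℕ → ℕ → F)
    (g h : Fin n → F[X]) (x : ι → F) (hx : IsGeneric q x)
    (m₀ : ℕ) (hm₀ : 0 < m₀)
    (hg : ∀ l s t, m₀ ≤ s + t → c l (s + 1) t ≠ 0 → (g l).natDegree < 2 * t)
    (hh : ∀ l s t, m₀ ≤ s + t → c l s (t + 1) ≠ 0 → (h l).natDegree < 2 * s)
    (a : ℕ → F → F)
    (ha : ∀ l s t y, c l (s + 1) (t + 1) * (g l).eval y * (h l).eval (q * y) * q ^ t =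
      a (s + t) y * c l s t)
    (base : ∀ B : Finset ι, #B ≤ m₀ →
      ∑ S ∈ B.powerset, splitTerm c g h x S (B \ S) * pairWeight q x S (B \ S) = 0)
    (B : Finset ι) :
    ∑ S ∈ B.powerset, splitTerm c g h x S (B \ S) * pairWeight q x S (B \ S) = 0 := by
  induction hm : #B using Nat.strong_induction_on generalizing B with
  | _ m ih =>
    by_cases hB : #B ≤ m₀
    · exact base B hB
    obtain ⟨b, hb⟩ : B.Nonempty := card_pos.1 (by omega)
    obtain ⟨B', hbB', rfl⟩ : ∃ B', b ∉ B' ∧ insert b B' = B :=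
      ⟨B.erase b, by simp, insert_erase hb⟩
    rw [card_insert_of_notMem hbB'] at hm hB
    refine sum_splitTerm_insert_eq_zero q c g h x B' hbB' (by omega) hx.ne_zero hx.ne_one
      hx.sq_ne_one (fun i _ => hx.coord_ne_zero i)
      (fun i _ j _ hij => hx.separated i j hij) (fun l s t hst => hg l s t (by omega))
      (fun l s t hst => hh l s t (by omega)) (a (#B' - 1)) (fun l s t y hst => ?_)
      (fun B'' _ hc => ih _ (by omega) B'' rfl)
    rw [ha]
    congr 2
    omega

end SubsetSums

/-! ### The subset-sum identities -/

section Identities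

variable {ι : Type*}

/-- The term of a splitting in the subset-sum identity behind `ShiftRep.E_mul_D_sub`: the sizes are
equal, or differ by two. -/
def balancedSummand {R : Type*} [CommRing R] (q τ : R) (x : ι → R) (S T : Finset ι) : R :=
  (∏ i ∈ S, (1 + τ * x i)) *
    ((if #S = #T then q ^ #S * (∏ i ∈ S, x i) * (∏ i ∈ T, x i) - (∏ i ∈ T, x i) ^ 2 else 0) -
      if #T = #S + 2 then q ^ #S * (∏ i ∈ S, x i) ^ 2 else 0)

/-- The term of a splitting in the subset-sum identity behind `ShiftRep.E_succ_mul_D_sub`: the sizes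
differ by one. -/
def adjacentSummand {R : Type*} [CommRing R] (q τ : R) (x : ι → R) (S T : Finset ι) : R :=
  (∏ i ∈ S, (1 + τ * x i)) *
    ((if #S = #T + 1 then q ^ #T * ∏ i ∈ T, x i else 0) -
      if #T = #S + 1 then q ^ #S * (∏ i ∈ S, x i) + τ * ∏ i ∈ T, x i else 0)

/-- The term of a splitting in the subset-sum identity behind `ShiftRep.C_D_succ_mul_C_D`, the
commutation of two neighbouring currents. -/
def commSummand {R : Type*} [CommRing R] (q : R) (x : ι → R) (S T : Finset ι) : R :=
  (if #S = #T + 1 then (∏ i ∈ T, x i) ^ 2 else 0) -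
      if #T = #S + 1 then q ^ #S * (∏ i ∈ S, x i) ^ 2 else 0

lemma map_balancedSummand {R R' : Type*} [CommRing R] [CommRing R'] (φ : R →+* R') (q τ : R)
    (x : ι → R) (S T : Finset ι) : φ (balancedSummand q τ x S T) =
      balancedSummand (φ q) (φ τ) (fun i => φ (x i)) S T := by
  simp only [balancedSummand, map_mul, map_prod, map_add, map_one, map_sub, apply_ite φ, map_pow,
    map_zero]

lemma map_adjacentSummand {R R' : Type*} [CommRing R] [CommRing R'] (φ : R →+* R') (q τ : R)
    (x : ι → R) (S T : Finset ι) : φ (adjacentSummand q τ x S T) =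
      adjacentSummand (φ q) (φ τ) (fun i => φ (x i)) S T := by
  simp only [adjacentSummand, map_mul, map_prod, map_add, map_one, map_sub, apply_ite φ, map_pow,
    map_zero]

lemma map_commSummand {R R' : Type*} [CommRing R] [CommRing R'] (φ : R →+* R') (q : R) (x : ι → R)
    (S T : Finset ι) : φ (commSummand q x S T) = commSummand (φ q) (fun i => φ (x i)) S T := by
  simp only [commSummand, map_prod, map_mul, map_sub, apply_ite φ, map_pow,
    map_zero]

variable {F : Type*} [Field F]

lemma balancedSummand_eq (q τ : F) (x : ι → F) (S T : Finset ι) : balancedSummand q τ x S T =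
    splitTerm ![fun s t => if s = t then q ^ s else 0, fun s t => if s = t then -1 else 0,
      fun s t => if t = s + 2 then -q ^ s else 0]
      ![(1 + C τ * X) * X, 1 + C τ * X, (1 + C τ * X) * X ^ 2] ![X, X ^ 2, 1] x S T := by
  simp only [splitTerm, Fin.sum_univ_three]
  simp [balancedSummand, prod_mul_distrib, prod_pow]
  split_ifs <;> ring

lemma adjacentSummand_eq (q τ : F) (x : ι → F) (S T : Finset ι) : adjacentSummand q τ x S T =
    splitTerm ![fun s t => if s = t + 1 then q ^ t else 0,
      fun s t => if t = s + 1 then -q ^ s else 0, fun s t => if t = s + 1 then -τ else 0]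
      ![1 + C τ * X, (1 + C τ * X) * X, 1 + C τ * X] ![X, 1, X] x S T := by
  simp only [splitTerm, Fin.sum_univ_three]
  simp [adjacentSummand, prod_mul_distrib]
  split_ifs <;> ring

lemma commSummand_eq (q : F) (x : ι → F) (S T : Finset ι) : commSummand q x S T =
    splitTerm ![fun s t => if s = t + 1 then 1 else 0, fun s t => if t = s + 1 then -q ^ s else 0]
      ![1, X ^ 2] ![X ^ 2, 1] x S T := by
  simp only [splitTerm, Fin.sum_univ_two]
  simp [commSummand, prod_pow]
  split_ifs <;> ring

lemma sum_balancedSummand_of_generic [DecidableEq ι] (q τ : F) {x : ι → F} (hx : IsGeneric q x)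
    (B : Finset ι) :
    ∑ S ∈ B.powerset, balancedSummand q τ x S (B \ S) * pairWeight q x S (B \ S) = 0 := by
  have d1 : (1 + C τ * X : F[X]).natDegree ≤ 1 := by compute_degree
  have d2 : ((1 + C τ * X) * X : F[X]).natDegree ≤ 2 := by compute_degree
  have d3 : ((1 + C τ * X) * X ^ 2 : F[X]).natDegree ≤ 3 := by compute_degree
  simp only [balancedSummand_eq]
  refine sum_splitTerm_eq_zero q _ _ _ x hx 2 (by norm_num) ?_ ?_
    (fun m y => (1 + τ * y) * y ^ 2 * q ^ (2 + m / 2)) ?_ ?_ B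
  · intro l s t hst
    fin_cases l <;> simp <;> intros <;> omega
  · intro l s t hst
    fin_cases l <;> simp <;> intros <;> omega
  · intro l s t y
    fin_cases l <;> simp
    · split_ifs with h
      · subst h
        rw [show (s + s) / 2 = s by omega]
        ring
      · simp
    · split_ifs with h
      · subst h
        rw [show (s + s) / 2 = s by omega]
        ring
      · simp
    · by_cases h : t = s + 2
      · subst h
        rw [show (s + (s + 2)) / 2 = s + 1 by omega]
        simp only [if_true]
        ring
      · rw [if_neg h, if_neg (by omega)]
  · intro B hB
    simp only [← balancedSummand_eq]
    interval_cases h : #B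
    · rw [card_eq_zero] at h
      simp [h, balancedSummand]
    · obtain ⟨i, rfl⟩ := card_eq_one.1 h
      rw [← insert_empty_eq, sum_powerset_insert (notMem_empty i)]
      simp [balancedSummand]
    · obtain ⟨i, j, hij, rfl⟩ := card_eq_two.1 h
      have e1 : ({i, j} : Finset ι) \ {i} = {j} := by
        ext a; simp; grind
      have e2 : ({i, j} : Finset ι) \ {j} = {i} := by
        ext a; simp; grind
      rw [sum_powerset_insert (by simpa using hij), ← insert_empty_eq j,
        sum_powerset_insert (notMem_empty j), sum_powerset_insert (notMem_empty j)]
      simp only [powerset_empty, sum_singleton, insert_empty_eq, e1, e2, sdiff_empty, sdiff_self]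
      have hc : #({i, j} : Finset ι) = 2 := h
      simp [balancedSummand, pairWeight, hc]
      obtain ⟨h1, h2, -⟩ := hx.separated i j hij
      obtain ⟨-, h3, -⟩ := hx.separated j i hij.symm
      have h1 := sub_ne_zero.2 h1
      have h1' : x j - x i ≠ 0 := fun h => h1 (by linear_combination -h)
      have h2 := sub_ne_zero.2 h2
      have h3 := sub_ne_zero.2 h3
      rw [mul_comm q (x j)] at h2
      field_simp
      ring

lemma sum_adjacentSummand_of_generic [DecidableEq ι] (q τ : F) {x : ι → F} (hx : IsGeneric q x)
    (B : Finset ι) :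
    ∑ S ∈ B.powerset, adjacentSummand q τ x S (B \ S) * pairWeight q x S (B \ S) = 0 := by
  have d1 : (1 + C τ * X : F[X]).natDegree ≤ 1 := by compute_degree
  have d2 : ((1 + C τ * X) * X : F[X]).natDegree ≤ 2 := by compute_degree
  simp only [adjacentSummand_eq]
  refine sum_splitTerm_eq_zero q _ _ _ x hx 1 (by norm_num) ?_ ?_
    (fun m y => (1 + τ * y) * y * q ^ (2 + m / 2)) ?_ ?_ B
  · intro l s t hst
    fin_cases l <;> simp <;> intros <;> omega
  · intro l s t hst
    fin_cases l <;> simp <;> intros <;> omega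
  · intro l s t y
    fin_cases l <;> simp
    · split_ifs with h
      · subst h
        rw [show (t + 1 + t) / 2 = t by omega]
        ring
      · simp
    · split_ifs with h
      · subst h
        rw [show (s + (s + 1)) / 2 = s by omega]
        ring
      · simp
    · split_ifs with h
      · subst h
        rw [show (s + (s + 1)) / 2 = s by omega]
        ring
      · simp
  · intro B hB
    simp only [← adjacentSummand_eq]
    interval_cases h : #B
    · rw [card_eq_zero] at h
      simp [h, adjacentSummand]
    · obtain ⟨i, rfl⟩ := card_eq_one.1 h
      rw [← insert_empty_eq, sum_powerset_insert (notMem_empty i)]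
      simp [adjacentSummand, pairWeight]

lemma sum_commSummand_of_generic [DecidableEq ι] (q : F) {x : ι → F} (hx : IsGeneric q x)
    (B : Finset ι) :
    ∑ S ∈ B.powerset, commSummand q x S (B \ S) * pairWeight q x S (B \ S) = 0 := by
  simp only [commSummand_eq]
  refine sum_splitTerm_eq_zero q _ _ _ x hx 1 (by norm_num) ?_ ?_
    (fun m y => y ^ 2 * q ^ (2 + m / 2)) ?_ ?_ B
  · intro l s t hst
    fin_cases l <;> simp <;> intros <;> omega
  · intro l s t hst
    fin_cases l <;> simp <;> intros <;> omega
  · intro l s t y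
    fin_cases l <;> simp
    · split_ifs with h
      · subst h
        rw [show (t + 1 + t) / 2 = t by omega]
        ring
      · simp
    · split_ifs with h
      · subst h
        rw [show (s + (s + 1)) / 2 = s by omega]
        ring
      · simp
  · intro B hB
    simp only [← commSummand_eq]
    interval_cases h : #B
    · rw [card_eq_zero] at h
      simp [h, commSummand]
    · obtain ⟨i, rfl⟩ := card_eq_one.1 h
      rw [← insert_empty_eq, sum_powerset_insert (notMem_empty i)]
      simp [commSummand, pairWeight]

end Identities

/-! ### Specialization of the generic identities -/

section Universal

variable {ι : Type*}

/-- The polynomial ring over `ℤ` in the independent variables `q`, `τ` and `x i`. -/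
abbrev UnivRing (ι : Type*) : Type _ := MvPolynomial (Option (Option ι)) ℤ

namespace UnivRing

/-- The variable of the universal ring standing for `q`. -/
noncomputable def q : UnivRing ι := MvPolynomial.X none

/-- The variable of the universal ring standing for `τ`. -/
noncomputable def τ : UnivRing ι := MvPolynomial.X (some none)

/-- The variables of the universal ring standing for the `x i`. -/
noncomputable def x (i : ι) : UnivRing ι := MvPolynomial.X (some (some i))

/-- The ring homomorphism that gives the variables `q`, `τ`, `x i` the values `q₀`, `τ₀`, `x₀ i`. -/
noncomputable def specialize {R : Type*} [CommRing R] (q₀ τ₀ : R) (x₀ : ι → R) :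
    UnivRing ι →+* R :=
  MvPolynomial.eval₂Hom (Int.castRingHom R) fun o => o.elim q₀ fun o' => o'.elim τ₀ x₀

section
variable {R : Type*} [CommRing R] (q₀ τ₀ : R) (x₀ : ι → R)

@[simp] lemma specialize_q : specialize q₀ τ₀ x₀ q = q₀ := by simp [specialize, q]

@[simp] lemma specialize_τ : specialize q₀ τ₀ x₀ τ = τ₀ := by simp [specialize, τ]

@[simp] lemma specialize_x (i : ι) : specialize q₀ τ₀ x₀ (x i) = x₀ i := by
  simp [specialize, x]

end

lemma isGeneric : IsGeneric (algebraMap (UnivRing ι) (FractionRing (UnivRing ι)) q)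
    (fun i : ι => algebraMap (UnivRing ι) (FractionRing (UnivRing ι)) (x i)) := by
  classical
  have hinj := IsFractionRing.injective (UnivRing ι) (FractionRing (UnivRing ι))
  -- Each relation is refuted by a specialization to integers.
  refine ⟨fun h => ?_, fun h => ?_, fun h => ?_, fun i h => ?_, fun i j hij =>
    ⟨fun h => ?_, fun h => ?_, fun h => ?_⟩⟩
  · have h := congrArg (specialize (1 : ℤ) 0 0) (hinj (h.trans (map_zero _).symm))
    simp at h
  · have h := congrArg (specialize (0 : ℤ) 0 0) (hinj (h.trans (map_one _).symm))
    simp at h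
  · rw [← map_pow] at h
    have h := congrArg (specialize (0 : ℤ) 0 0) (hinj (h.trans (map_one _).symm))
    simp at h
  · have h := congrArg (specialize (1 : ℤ) 0 1) (hinj (h.trans (map_zero _).symm))
    simp at h
  · have h := congrArg (specialize (1 : ℤ) 0 (Pi.single i 1)) (hinj h)
    simp [hij.symm] at h
  · rw [← map_mul] at h
    have h := congrArg (specialize (1 : ℤ) 0 (Pi.single i 1)) (hinj h)
    simp [hij.symm] at h
  · rw [← map_pow, ← map_mul] at h
    have h := congrArg (specialize (1 : ℤ) 0 (Pi.single i 1)) (hinj h)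
    simp [hij.symm] at h

end UnivRing

/-- `pairWeight q x S (B \ S)` multiplied by the common denominator, the product over all ordered
pairs of distinct elements of `B`; unlike `pairWeight`, it makes sense in any commutative ring. -/
noncomputable def coWeight [DecidableEq ι] {R : Type*} [CommRing R] (q : R) (x : ι → R)
    (B S : Finset ι) : R :=
  ∏ p ∈ B.offDiag \ (S ×ˢ (B \ S)), (x p.1 - x p.2) * (x p.2 - q * x p.1)

lemma map_coWeight [DecidableEq ι] {R R' : Type*} [CommRing R] [CommRing R'] (φ : R →+* R') (q : R)
    (x : ι → R) (B S : Finset ι) :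
    φ (coWeight q x B S) = coWeight (φ q) (fun i => φ (x i)) B S := by
  simp [coWeight]

lemma pairWeight_mul_prod_offDiag [DecidableEq ι] {F : Type*} [Field F] (q : F) (x : ι → F)
    {B S : Finset ι} (hS : S ⊆ B)
    (hx : ∀ i ∈ B, ∀ j ∈ B, i ≠ j → x i ≠ x j ∧ x i ≠ q * x j) :
    pairWeight q x S (B \ S) * ∏ p ∈ B.offDiag, (x p.1 - x p.2) * (x p.2 - q * x p.1) =
      coWeight q x B S := by
  have hsub : S ×ˢ (B \ S) ⊆ B.offDiag := by
    intro p hp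
    simp only [mem_product, mem_sdiff, mem_offDiag] at hp ⊢
    exact ⟨hS hp.1, hp.2.1, fun h => hp.2.2 (h ▸ hp.1)⟩
  rw [← prod_sdiff hsub, coWeight, mul_left_comm, pairWeight, ← prod_product', ← prod_mul_distrib]
  refine (congrArg _ (prod_eq_one fun p hp => ?_)).trans (mul_one _)
  have hp' := mem_offDiag.1 (hsub hp)
  exact inv_mul_cancel₀ (mul_ne_zero (sub_ne_zero.2 (hx _ hp'.1 _ hp'.2.1 hp'.2.2).1)
    (sub_ne_zero.2 (hx _ hp'.2.1 _ hp'.1 hp'.2.2.symm).2))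

/-- An identity with denominators that holds for independent variables holds at all points for which
the denominators do not vanish, even if these points, or `q`, are not generic: after clearing
denominators it is an identity in a polynomial ring over `ℤ`. -/
lemma sum_specialize_mul_pairWeight_eq_zero [DecidableEq ι] {K R : Type*} [Field K] [CommRing R]
    [Algebra K R] (q : K) (τ : R) (x : ι → K) (B : Finset ι)
    (hx : ∀ i ∈ B, ∀ j ∈ B, i ≠ j → x i ≠ x j ∧ x i ≠ q * x j)
    (f : Finset ι → Finset ι → UnivRing ι)
    (hf : ∑ S ∈ B.powerset, algebraMap (UnivRing ι) (FractionRing (UnivRing ι)) (f S (B \ S)) *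
      pairWeight (algebraMap (UnivRing ι) (FractionRing (UnivRing ι)) UnivRing.q)
        (fun i => algebraMap (UnivRing ι) (FractionRing (UnivRing ι)) (UnivRing.x i))
        S (B \ S) = 0) :
    ∑ S ∈ B.powerset, UnivRing.specialize (algebraMap K R q) τ (fun i => algebraMap K R (x i))
      (f S (B \ S)) * algebraMap K R (pairWeight q x S (B \ S)) = 0 := by
  have huniv : ∑ S ∈ B.powerset, f S (B \ S) * coWeight UnivRing.q UnivRing.x B S = 0 := by
    apply IsFractionRing.injective (UnivRing ι) (FractionRing (UnivRing ι))
    rw [map_zero, map_sum, ← zero_mul (∏ p ∈ B.offDiag, _), ← hf, sum_mul]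
    refine sum_congr rfl fun S hS => ?_
    rw [mul_assoc, pairWeight_mul_prod_offDiag _ _ (mem_powerset.1 hS), map_mul, map_coWeight]
    intro i _ j _ hij
    have := UnivRing.isGeneric.separated i j hij
    exact ⟨this.1, this.2.1⟩
  have hspec := congrArg (UnivRing.specialize (algebraMap K R q) τ fun i => algebraMap K R (x i))
    huniv
  simp only [map_sum, map_zero, map_mul, map_coWeight, UnivRing.specialize_q,
    UnivRing.specialize_x] at hspec
  simp only [← map_coWeight] at hspec
  have hunit : IsUnit (algebraMap K R
      (∏ p ∈ B.offDiag, (x p.1 - x p.2) * (x p.2 - q * x p.1))) := by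
    refine IsUnit.map _ (IsUnit.mk0 _ (prod_ne_zero_iff.2 fun p hp => ?_))
    simp only [mem_offDiag] at hp
    exact mul_ne_zero (sub_ne_zero.2 (hx _ hp.1 _ hp.2.1 hp.2.2).1)
      (sub_ne_zero.2 (hx _ hp.2.1 _ hp.1 hp.2.2.symm).2)
  rw [← hunit.mul_left_eq_zero, ← hspec, sum_mul]
  refine sum_congr rfl fun S hS => ?_
  rw [mul_assoc, ← map_mul, pairWeight_mul_prod_offDiag q x (mem_powerset.1 hS) hx]

section
variable [DecidableEq ι] {K R : Type*} [Field K] [CommRing R]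
    [Algebra K R] (q : K) (τ : R) (x : ι → K) (B : Finset ι)

lemma sum_balancedSummand_eq_zero
    (hx : ∀ i ∈ B, ∀ j ∈ B, i ≠ j → x i ≠ x j ∧ x i ≠ q * x j) :
    ∑ S ∈ B.powerset,
      balancedSummand (algebraMap K R q) τ (fun i => algebraMap K R (x i)) S (B \ S) *
        algebraMap K R (pairWeight q x S (B \ S)) = 0 := by
  have h := sum_specialize_mul_pairWeight_eq_zero q τ x B hx
    (balancedSummand UnivRing.q UnivRing.τ UnivRing.x) ?_
  · simpa only [map_balancedSummand, UnivRing.specialize_q, UnivRing.specialize_τ,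
      UnivRing.specialize_x] using h
  · simp only [map_balancedSummand]
    exact sum_balancedSummand_of_generic _ _ UnivRing.isGeneric B

lemma sum_adjacentSummand_eq_zero
    (hx : ∀ i ∈ B, ∀ j ∈ B, i ≠ j → x i ≠ x j ∧ x i ≠ q * x j) :
    ∑ S ∈ B.powerset,
      adjacentSummand (algebraMap K R q) τ (fun i => algebraMap K R (x i)) S (B \ S) *
        algebraMap K R (pairWeight q x S (B \ S)) = 0 := by
  have h := sum_specialize_mul_pairWeight_eq_zero q τ x B hx
    (adjacentSummand UnivRing.q UnivRing.τ UnivRing.x) ?_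
  · simpa only [map_adjacentSummand, UnivRing.specialize_q, UnivRing.specialize_τ,
      UnivRing.specialize_x] using h
  · simp only [map_adjacentSummand]
    exact sum_adjacentSummand_of_generic _ _ UnivRing.isGeneric B

lemma sum_commSummand_eq_zero
    (hx : ∀ i ∈ B, ∀ j ∈ B, i ≠ j → x i ≠ x j ∧ x i ≠ q * x j) :
    ∑ S ∈ B.powerset, commSummand (algebraMap K R q) (fun i => algebraMap K R (x i)) S (B \ S) *
      algebraMap K R (pairWeight q x S (B \ S)) = 0 := by
  have h := sum_specialize_mul_pairWeight_eq_zero q (0 : R) x B hx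
    (commSummand UnivRing.q UnivRing.x) ?_
  · simpa only [map_commSummand, UnivRing.specialize_q, UnivRing.specialize_x] using h
  · simp only [map_commSummand]
    exact sum_commSummand_of_generic _ UnivRing.isGeneric B

end

end Universal

/-! ### The coordinate functions and their shifts -/

section Coordinates

variable (r : ℕ) (k : Type*) [Field k]

lemma z_castSucc (i : Fin r) : z r k i.castSucc =
    algebraMap (MvPolynomial (Fin r) k) (RatFun r k) (MvPolynomial.X i) := by
  simp [z]

lemma algebraMap_X_ne_zero (i : Fin r) :
    algebraMap (MvPolynomial (Fin r) k) (RatFun r k) (MvPolynomial.X i) ≠ 0 := by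
  simp

lemma prod_z : ∏ i, z r k i = 1 := by
  rw [Fin.prod_univ_castSucc]
  simp only [z, Fin.snoc_castSucc, Fin.snoc_last]
  exact mul_inv_cancel₀ (prod_ne_zero_iff.2 fun i _ => algebraMap_X_ne_zero r k i)

lemma z_ne_zero (i : Fin (r + 1)) : z r k i ≠ 0 :=
  prod_ne_zero_iff.1 (prod_z r k ▸ one_ne_zero) i (mem_univ i)

/-- Distinct coordinates are not proportional. -/
lemma z_ne_algebraMap_mul_z {i j : Fin (r + 1)} (hij : i ≠ j) (c : kˣ) :
    z r k i ≠ algebraMap k (RatFun r k) c * z r k j := by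
  have hinj := IsFractionRing.injective (MvPolynomial (Fin r) k) (RatFun r k)
  have hlast : ∀ (j : Fin r) (c : kˣ),
      z r k (Fin.last r) ≠ algebraMap k (RatFun r k) c * z r k j.castSucc := by
    intro j c h
    have h1 := prod_z r k
    rw [Fin.prod_univ_castSucc, h] at h1
    simp only [z_castSucc, ← map_prod, IsScalarTower.algebraMap_apply k (MvPolynomial (Fin r) k)
      (RatFun r k), ← map_mul] at h1
    -- A relation `z_{r+1} = c z_j` would turn the product of all coordinates into a polynomial
    -- without constant term, while it is `1`.
    have h2 := congrArg (MvPolynomial.aeval (0 : Fin r → k)) (hinj (h1.trans (map_one _).symm))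
    simp at h2
  induction i using Fin.lastCases with
  | last =>
    induction j using Fin.lastCases with
    | last => exact absurd rfl hij
    | cast j => exact hlast j c
  | cast i =>
    induction j using Fin.lastCases with
    | last =>
      intro h
      refine hlast i c⁻¹ ?_
      rw [h, ← mul_assoc, ← map_mul]
      simp
    | cast j =>
      intro h
      simp only [z_castSucc, IsScalarTower.algebraMap_apply k (MvPolynomial (Fin r) k)
        (RatFun r k), ← map_mul] at h
      have hij' : j ≠ i := fun h => hij (by rw [h])
      have h2 := congrArg (MvPolynomial.aeval (Pi.single i 1 : Fin r → k)) (hinj h)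
      simp [hij'] at h2

lemma z_injective : Function.Injective (z r k) := by
  intro i j h
  by_contra hij
  exact z_ne_algebraMap_mul_z r k hij 1 (by simpa using h)

variable {r k}

lemma prod_z_ne_zero (I : Finset (Fin (r + 1))) : ∏ i ∈ I, z r k i ≠ 0 :=
  prod_ne_zero_iff.2 fun i _ => z_ne_zero r k i

lemma prod_shiftFactor_eq (u : kˣ) (I : Finset (Fin (r + 1))) (j : Fin (r + 1)) :
    ∏ i ∈ I, shiftFactor u i j = (u ^ 2) ^ #I * if j ∈ I then qOf r u else 1 := by
  simp only [shiftFactor, prod_mul_distrib, prod_const, prod_ite_eq]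

/-- The parameter `u` as a constant rational function. -/
noncomputable abbrev uK (u : kˣ) : RatFun r k := algebraMap k (RatFun r k) u

lemma uK_ne_zero (u : kˣ) : (uK u : RatFun r k) ≠ 0 := by simp [uK]

/-- The parameter `q = u ^ (-2 (r + 1))` as a constant rational function. -/
noncomputable abbrev qK (u : kˣ) : RatFun r k := algebraMap k (RatFun r k) (qOf r u : kˣ)

lemma qK_eq (u : kˣ) : (qK u : RatFun r k) = uK u ^ (-2 * ((r : ℤ) + 1)) := by
  rw [neg_mul, zpow_neg, qK, qOf, uK, ← pow_mul]
  norm_cast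

lemma qK_ne_zero (u : kˣ) : (qK u : RatFun r k) ≠ 0 := by simp [qK]

lemma shift_z_eq (u : kˣ) (I : Finset (Fin (r + 1))) (j : Fin (r + 1)) :
    shift u I (z r k j) = uK u ^ (2 * #I) * ((if j ∈ I then qK u else 1) * z r k j) := by
  rw [shift_z, prod_shiftFactor_eq, ← pow_mul]
  split_ifs <;> simp [mul_assoc]

lemma shift_prod_z_zpow (u : kˣ) (I J : Finset (Fin (r + 1))) (n : ℤ) :
    shift u I ((∏ j ∈ J, z r k j) ^ n) =
      uK u ^ (n * (2 * #I * #J - 2 * ((r : ℤ) + 1) * #(I ∩ J))) * (∏ j ∈ J, z r k j) ^ n := by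
  rw [map_zpow₀, map_prod]
  simp only [shift_z_eq, prod_mul_distrib, prod_const]
  rw [prod_ite_mem, prod_const, ← mul_assoc, mul_zpow, mul_comm n, zpow_mul, inter_comm J I]
  congr 2
  rw [qK_eq, ← zpow_natCast, ← zpow_natCast, ← zpow_natCast, ← zpow_mul, ← zpow_mul,
    ← zpow_add₀ (uK_ne_zero u)]
  congr 1

/-- The factor of `a_{A ∪ S} · D_{A ∪ S}(a_{A ∪ T})` that depends on `A` and on the disjoint union
`B = S ∪ T`, but not on the way in which `B` is split. -/
noncomputable def kappa (u : kˣ) (A B : Finset (Fin (r + 1))) : RatFun r k :=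
  (∏ i ∈ A, ∏ j ∈ (A ∪ B)ᶜ, z r k i / (z r k i - z r k j) *
      (qK u * z r k i / (qK u * z r k i - z r k j))) *
    ((∏ i ∈ A, ∏ j ∈ B, z r k i / (z r k i - z r k j)) *
      ∏ i ∈ B, ∏ j ∈ (A ∪ B)ᶜ, z r k i / (z r k i - z r k j))

/-- Pairs inside `A ∪ S` are scaled by a common factor and contribute as if there were no shift; the
pairs between `S` and `T = B \ S` give the weight of the splitting; all others go into `kappa`. -/
lemma aCoeff_mul_shift_aCoeff (u : kˣ) {A B S : Finset (Fin (r + 1))} (hAB : Disjoint A B)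
    (hS : S ⊆ B) :
    aCoeff k (A ∪ S) * shift u (A ∪ S) (aCoeff k (A ∪ (B \ S))) =
      kappa u A B * ((∏ i ∈ S, z r k i) ^ #(B \ S) * (∏ i ∈ B \ S, z r k i) ^ #S *
        pairWeight (qK u) (z r k) S (B \ S)) := by
  obtain ⟨T, rfl, hST⟩ : ∃ T, S ∪ T = B ∧ Disjoint S T :=
    ⟨B \ S, union_sdiff_of_subset hS, disjoint_sdiff⟩
  have hT : (S ∪ T) \ S = T := union_sdiff_cancel_left hST
  rw [hT]
  obtain ⟨hAS, hAT⟩ := disjoint_union_right.1 hAB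
  set C := (A ∪ (S ∪ T))ᶜ with hC
  have hCA : Disjoint C A := disjoint_compl_left.mono_right subset_union_left
  have hCS : Disjoint C S := disjoint_compl_left.mono_right
    (subset_union_left.trans subset_union_right)
  have hCT : Disjoint C T := disjoint_compl_left.mono_right
    (subset_union_right.trans subset_union_right)
  have hI : (A ∪ S)ᶜ = C ∪ T := by
    ext i
    have := fun h : i ∈ _ => disjoint_left.1 hAT h
    have := fun h : i ∈ _ => disjoint_left.1 hST h
    simp only [hC, mem_compl, mem_union]
    tauto
  have hJ : (A ∪ T)ᶜ = C ∪ S := by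
    ext i
    have := fun h : i ∈ _ => disjoint_left.1 hAS h
    have := fun h : i ∈ _ => disjoint_left.1 hST h
    simp only [hC, mem_compl, mem_union]
    tauto
  have hv := pow_ne_zero (2 * #(A ∪ S)) (uK_ne_zero (r := r) u)
  have hsh : ∀ i j, shift u (A ∪ S) (z r k i / (z r k i - z r k j)) =
      ((if i ∈ A ∪ S then qK u else 1) * z r k i) /
        ((if i ∈ A ∪ S then qK u else 1) * z r k i -
          (if j ∈ A ∪ S then qK u else 1) * z r k j) := by
    intro i j
    rw [map_div₀, map_sub, shift_z_eq, shift_z_eq, ← mul_sub, mul_div_mul_left _ _ hv]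
  have hAm : ∀ i ∈ A, i ∈ A ∪ S := fun i hi => mem_union_left _ hi
  have hSm : ∀ i ∈ S, i ∈ A ∪ S := fun i hi => mem_union_right _ hi
  have hCm : ∀ i ∈ C, i ∉ A ∪ S := fun i hi h => by
    rcases mem_union.1 h with h | h
    · exact disjoint_left.1 hCA hi h
    · exact disjoint_left.1 hCS hi h
  have hTm : ∀ i ∈ T, i ∉ A ∪ S := fun i hi h => by
    rcases mem_union.1 h with h | h
    · exact disjoint_left.1 hAT h hi
    · exact disjoint_left.1 hST h hi
  have hq := qK_ne_zero (r := r) u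
  have e1 : ∏ i ∈ A, ∏ j ∈ C, shift u (A ∪ S) (z r k i / (z r k i - z r k j)) =
      ∏ i ∈ A, ∏ j ∈ C, qK u * z r k i / (qK u * z r k i - z r k j) :=
    prod_congr rfl fun i hi => prod_congr rfl fun j hj => by
      rw [hsh, if_pos (hAm i hi), if_neg (hCm j hj), one_mul]
  have e2 : ∏ i ∈ A, ∏ j ∈ S, shift u (A ∪ S) (z r k i / (z r k i - z r k j)) =
      ∏ i ∈ A, ∏ j ∈ S, z r k i / (z r k i - z r k j) :=
    prod_congr rfl fun i hi => prod_congr rfl fun j hj => by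
      rw [hsh, if_pos (hAm i hi), if_pos (hSm j hj), ← mul_sub, mul_div_mul_left _ _ hq]
  have e3 : ∏ i ∈ T, ∏ j ∈ C, shift u (A ∪ S) (z r k i / (z r k i - z r k j)) =
      ∏ i ∈ T, ∏ j ∈ C, z r k i / (z r k i - z r k j) :=
    prod_congr rfl fun i hi => prod_congr rfl fun j hj => by
      rw [hsh, if_neg (hTm i hi), if_neg (hCm j hj), one_mul, one_mul]
  have e4 : ∏ i ∈ T, ∏ j ∈ S, shift u (A ∪ S) (z r k i / (z r k i - z r k j)) =
      ∏ i ∈ S, ∏ j ∈ T, z r k j / (z r k j - qK u * z r k i) := by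
    rw [prod_comm]
    exact prod_congr rfl fun i hi => prod_congr rfl fun j hj => by
      rw [hsh, if_neg (hTm j hj), if_pos (hSm i hi), one_mul]
  have e5 : (∏ i ∈ S, z r k i) ^ #T * (∏ i ∈ T, z r k i) ^ #S *
        pairWeight (qK u) (z r k) S T =
      (∏ i ∈ S, ∏ j ∈ T, z r k i / (z r k i - z r k j)) *
        ∏ i ∈ S, ∏ j ∈ T, z r k j / (z r k j - qK u * z r k i) := by
    have h1 : (∏ i ∈ S, z r k i) ^ #T = ∏ i ∈ S, ∏ _j ∈ T, z r k i := by
      simp only [prod_const, prod_pow]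
    have h2 : (∏ i ∈ T, z r k i) ^ #S = ∏ _i ∈ S, ∏ j ∈ T, z r k j := by
      rw [prod_const]
    simp only [h1, h2, pairWeight, ← prod_mul_distrib]
    refine prod_congr rfl fun i _ => prod_congr rfl fun j _ => ?_
    rw [div_mul_div_comm, div_eq_mul_inv]
  rw [e5]
  simp only [aCoeff, hI, hJ, map_prod]
  rw [prod_union hAS, prod_union hAT]
  simp only [prod_union hCT, prod_union hCS, prod_mul_distrib, e1, e2, e3, e4, kappa, ← hC,
    prod_union hST]
  ring

end Coordinates

/-! ### The algebra of difference operators -/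

section OperatorRing

variable {r : ℕ} {k : Type*} [Field k]

/-- Multiplication operators, as a ring homomorphism. -/
noncomputable def mulOpHom (r : ℕ) (k : Type*) [Field k] : RatFun r k →+* FormalOp r k :=
  HahnSeries.C.comp (Algebra.lmul k (RatFun r k)).toRingHom

lemma mulOpHom_apply (f : RatFun r k) : mulOpHom r k f = mulOp f := rfl

/-- The operator `D_I`, placed in its degree. -/
noncomputable def shiftOp (u : kˣ) (σ : Equiv.Perm (Fin (r + 1))) (I : Finset (Fin (r + 1))) :
    FormalOp r k :=
  HahnSeries.single (shiftDegree σ I) (shift u I).toLinearMap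

variable (u : kˣ) (σ : Equiv.Perm (Fin (r + 1)))

lemma single_eq_mulOpHom_mul_shiftOp (I : Finset (Fin (r + 1))) (f : RatFun r k) :
    HahnSeries.single (shiftDegree σ I) (LinearMap.mulLeft k f ∘ₗ (shift u I).toLinearMap) =
      mulOpHom r k f * shiftOp u σ I := by
  rw [mulOpHom_apply, mulOp, shiftOp, HahnSeries.C_apply, HahnSeries.single_mul_single, zero_add]
  rfl

lemma shiftOp_mul_mulOpHom (I : Finset (Fin (r + 1))) (f : RatFun r k) :
    shiftOp u σ I * mulOpHom r k f = mulOpHom r k (shift u I f) * shiftOp u σ I := by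
  rw [mulOpHom_apply, mulOpHom_apply, mulOp, mulOp, shiftOp, HahnSeries.C_apply,
    HahnSeries.C_apply, HahnSeries.single_mul_single, HahnSeries.single_mul_single, zero_add,
    add_zero]
  congr 1
  ext g
  simp

lemma smul_eq_mulOpHom_mul (c : k) (x : FormalOp r k) :
    c • x = mulOpHom r k (algebraMap k (RatFun r k) c) * x := by
  rw [mulOpHom_apply, mulOp, HahnSeries.C_mul_eq_smul]
  ext d f
  simp [Algebra.smul_def]

lemma polyDilation_mul (c c' : Fin r → kˣ) (p : MvPolynomial (Fin r) k) :
    polyDilation c (polyDilation c' p) = polyDilation (c * c') p := by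
  have h : (polyDilation c).toAlgHom.comp (polyDilation c').toAlgHom =
      (polyDilation (c * c')).toAlgHom := by
    ext j : 1
    simp [polyDilation, MvPolynomial.algebraMap_eq]
    ring
  exact DFunLike.congr_fun h p

lemma dilation_mul (c c' : Fin r → kˣ) (f : RatFun r k) :
    dilation c (dilation c' f) = dilation (c * c') f := by
  obtain ⟨a, b, -, rfl⟩ := IsFractionRing.div_surjective (A := MvPolynomial (Fin r) k) f
  simp only [map_div₀, dilation, IsFractionRing.algEquivOfAlgEquiv_algebraMap, polyDilation_mul]

lemma shift_shift (I J : Finset (Fin (r + 1))) (f : RatFun r k) :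
    shift u I (shift u J f) = shift u (I ∩ J) (shift u (I ∪ J) f) := by
  simp only [shift, dilation_mul]
  congr 2
  ext j
  simp only [Pi.mul_apply]
  rw [← prod_union_inter, mul_comm]

lemma shiftDegree_add (I J : Finset (Fin (r + 1))) :
    shiftDegree σ I + shiftDegree σ J = shiftDegree σ (I ∩ J) + shiftDegree σ (I ∪ J) := by
  have h : ∀ p : Fin (r + 1) → Prop, ∀ [DecidablePred p],
      #{l | p l ∧ σ l ∈ I} + #{l | p l ∧ σ l ∈ J} =
        #{l | p l ∧ σ l ∈ I ∩ J} + #{l | p l ∧ σ l ∈ I ∪ J} := by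
    intro p _
    rw [← card_union_add_card_inter, ← filter_or, ← filter_and, add_comm]
    congr 2 <;> ext l <;> simp only [mem_filter, mem_univ, mem_union, mem_inter] <;> tauto
  ext i
  have h1 := h (fun l => l ≤ i.castSucc)
  have h2 := card_union_add_card_inter I J
  simp only [shiftDegree, Pi.add_apply]
  zify at h1 h2
  linear_combination (-(i : ℤ) - 1) * h2 - ((r : ℤ) + 1) * h1

lemma shiftOp_mul_shiftOp (I J : Finset (Fin (r + 1))) :
    (shiftOp u σ I * shiftOp u σ J : FormalOp r k) =
      shiftOp u σ (I ∩ J) * shiftOp u σ (I ∪ J) := by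
  have h : (shift (k := k) u I).toLinearMap * (shift u J).toLinearMap =
      (shift u (I ∩ J)).toLinearMap * (shift u (I ∪ J)).toLinearMap := by
    refine LinearMap.ext fun f => ?_
    simp only [Module.End.mul_apply, AlgEquiv.toLinearMap_apply, shift_shift u I J]
  simp only [shiftOp, HahnSeries.single_mul_single]
  rw [h, shiftDegree_add σ I J]

/-- A ring with elements `mul f` for the rational functions `f`, and elements `shiftOp I` for the
shifts `D_I`, subject to the relations between these operators. In the last relation the
symmetric role of `I` and `J` expresses that `D_I D_J` depends only on the multiset union of `I`
and `J`. The identities between the currents follow from these relations alone. -/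
structure ShiftRep (r : ℕ) (k : Type*) [Field k] (u : kˣ) (𝓡 : Type*) [Ring 𝓡] where
  mul : RatFun r k →+* 𝓡
  shiftOp : Finset (Fin (r + 1)) → 𝓡
  shiftOp_empty : shiftOp ∅ = 1
  shiftOp_univ : shiftOp univ = 1
  shiftOp_mul_mul : ∀ I f, shiftOp I * mul f = mul (shift u I f) * shiftOp I
  shiftOp_mul_shiftOp : ∀ I J, shiftOp I * shiftOp J = shiftOp (I ∩ J) * shiftOp (I ∪ J)

lemma dilation_one (f : RatFun r k) : dilation (1 : Fin r → kˣ) f = f := by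
  obtain ⟨g, rfl⟩ := (dilation (1 : Fin r → kˣ)).surjective f
  rw [dilation_mul, mul_one]

lemma shift_empty : (shift u ∅).toLinearMap = (1 : Module.End k (RatFun r k)) :=
  LinearMap.ext fun f => dilation_one f

lemma shift_univ : (shift u univ).toLinearMap = (1 : Module.End k (RatFun r k)) := by
  have h : (fun j : Fin r => ∏ i, shiftFactor u i j.castSucc) = 1 := by
    ext j
    rw [prod_shiftFactor_eq]
    simp [qOf]
  rw [shift, h]
  exact LinearMap.ext fun f => dilation_one f

lemma shiftDegree_empty : shiftDegree σ ∅ = 0 := by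
  ext i
  simp [shiftDegree]

lemma shiftDegree_univ : shiftDegree σ univ = 0 := by
  ext i
  have h : #{l : Fin (r + 1) | l ≤ i.castSucc} = (i : ℕ) + 1 := by
    have : ({l : Fin (r + 1) | l ≤ i.castSucc} : Finset _) = Finset.Iic i.castSucc := by
      ext; simp
    rw [this, Fin.card_Iic]
    simp
  simp only [shiftDegree, mem_univ, and_true, h, card_univ, Fintype.card_fin]
  push_cast
  simp
  ring

/-- The ring of formal difference operators carries such elements. -/
noncomputable def formalRep : ShiftRep r k u (FormalOp r k) where
  mul := mulOpHom r k
  shiftOp := shiftOp u σ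
  shiftOp_empty := by
    rw [shiftOp, shiftDegree_empty, shift_empty]
    rfl
  shiftOp_univ := by
    rw [shiftOp, shiftDegree_univ, shift_univ]
    rfl
  shiftOp_mul_mul := shiftOp_mul_mulOpHom u σ
  shiftOp_mul_shiftOp := shiftOp_mul_shiftOp u σ

end OperatorRing

section Rep

variable {r : ℕ} {k : Type*} [Field k] {u : kˣ} {𝓡 : Type*} [Ring 𝓡] (ρ : ShiftRep r k u 𝓡)

namespace ShiftRep

/-- Multiplication operators, with polynomials as functions, and a central variable `X`. -/
noncomputable def mulPoly : (RatFun r k)[X] →+* 𝓡[X] := Polynomial.mapRingHom ρ.mul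

lemma mulPoly_C (f : RatFun r k) : ρ.mulPoly (C f) = C (ρ.mul f) := by
  simp [mulPoly]

lemma mulPoly_X : ρ.mulPoly X = X := by
  simp [mulPoly]

lemma C_shiftOp_mul_mulPoly_C (I : Finset (Fin (r + 1))) (f : RatFun r k) :
    C (ρ.shiftOp I) * ρ.mulPoly (C f) = ρ.mulPoly (C (shift u I f)) * C (ρ.shiftOp I) := by
  rw [mulPoly_C, mulPoly_C, ← C_mul, ← C_mul, ρ.shiftOp_mul_mul]

/-- The product of two sums of shifts, written as a sum over all pairs `(I, J)`. The shift belonging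
to a pair depends only on the intersection and the union of `I` and `J`. -/
lemma sum_mul_sum_shiftOp (P Q : Finset (Finset (Fin (r + 1))))
    (f : Finset (Fin (r + 1)) → (RatFun r k)[X]) (g : Finset (Fin (r + 1)) → RatFun r k) :
    (∑ I ∈ P, ρ.mulPoly (f I) * C (ρ.shiftOp I)) *
      (∑ J ∈ Q, ρ.mulPoly (C (g J)) * C (ρ.shiftOp J)) =
    ∑ I, ∑ J, ρ.mulPoly (if I ∈ P ∧ J ∈ Q then f I * C (shift u I (g J)) else 0) *
      C (ρ.shiftOp (I ∩ J) * ρ.shiftOp (I ∪ J)) := by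
  classical
  have h : ∀ (P : Finset (Finset (Fin (r + 1)))) (F : Finset (Fin (r + 1)) → 𝓡[X]),
      ∑ I ∈ P, F I = ∑ I, if I ∈ P then F I else 0 := fun P F => by simp
  rw [sum_mul_sum, h]
  refine sum_congr rfl fun I _ => ?_
  rw [h]
  by_cases hI : I ∈ P
  · rw [if_pos hI]
    refine sum_congr rfl fun J _ => ?_
    by_cases hJ : J ∈ Q
    · rw [if_pos hJ, if_pos ⟨hI, hJ⟩, mul_assoc, ← mul_assoc (C _), C_shiftOp_mul_mulPoly_C,
        mul_assoc, ← C_mul, ρ.shiftOp_mul_shiftOp,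
        map_mul (ρ.mulPoly), mul_assoc]
    · rw [if_neg hJ, if_neg (fun h => hJ h.2), map_zero, zero_mul]
  · rw [if_neg hI, eq_comm]
    refine sum_eq_zero fun J _ => ?_
    rw [if_neg (fun h => hI h.1), map_zero, zero_mul]

/-- A bilinear combination of shifts vanishes if, for all disjoint `A` and `B`, the sum of its
coefficients over the pairs with intersection `A` and symmetric difference `B` vanishes. -/
lemma sum_mulPoly_mul_shiftOp_eq_zero
    (Ω : Finset (Fin (r + 1)) → Finset (Fin (r + 1)) → (RatFun r k)[X])
    (hΩ : ∀ A B, Disjoint A B → ∑ S ∈ B.powerset, Ω (A ∪ S) (A ∪ (B \ S)) = 0) :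
    ∑ I, ∑ J, ρ.mulPoly (Ω I J) * C (ρ.shiftOp (I ∩ J) * ρ.shiftOp (I ∪ J)) = 0 := by
  classical
  rw [← sum_product', ← sum_fiberwise _ (fun p => (p.1 ∩ p.2, p.1 ∪ p.2))]
  refine sum_eq_zero fun q _ => ?_
  obtain ⟨A, U⟩ := q
  have h1 : ∀ p ∈ (univ ×ˢ univ : Finset (Finset (Fin (r + 1)) × Finset (Fin (r + 1)))).filter
      (fun p => (p.1 ∩ p.2, p.1 ∪ p.2) = (A, U)),
      ρ.mulPoly (Ω p.1 p.2) * C (ρ.shiftOp (p.1 ∩ p.2) * ρ.shiftOp (p.1 ∪ p.2)) =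
        ρ.mulPoly (Ω p.1 p.2) * C (ρ.shiftOp A * ρ.shiftOp U) := by
    intro p hp
    have := (mem_filter.1 hp).2
    rw [Prod.mk.injEq] at this
    rw [this.1, this.2]
  rw [sum_congr rfl h1, ← sum_mul, ← map_sum]
  convert zero_mul _
  rw [← map_zero (ρ.mulPoly)]
  congr 1
  by_cases hAU : A ⊆ U
  · rw [← hΩ A (U \ A) disjoint_sdiff]
    refine sum_bij' (fun p _ => p.1 \ p.2) (fun S _ => (A ∪ S, A ∪ ((U \ A) \ S))) ?_ ?_ ?_ ?_ ?_
    · rintro ⟨I, J⟩ hp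
      obtain ⟨rfl, rfl⟩ := Prod.mk.injEq .. ▸ (mem_filter.1 hp).2
      rw [mem_powerset]
      intro i
      simp only [mem_sdiff, mem_union, mem_inter]
      tauto
    · intro S hS
      have hS' := mem_powerset.1 hS
      simp only [mem_filter, mem_product, mem_univ, true_and, Prod.mk.injEq]
      constructor
      · ext i
        simp only [mem_sdiff, mem_union, mem_inter]
        tauto
      · ext i
        have h1 := @hS' i
        have h2 := @hAU i
        simp only [mem_sdiff, mem_union] at h1 ⊢
        tauto
    · rintro ⟨I, J⟩ hp
      obtain ⟨rfl, rfl⟩ := Prod.mk.injEq .. ▸ (mem_filter.1 hp).2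
      rw [Prod.mk.injEq]
      constructor
      · ext i
        simp only [mem_sdiff, mem_union, mem_inter]
        tauto
      · ext i
        simp only [mem_sdiff, mem_union, mem_inter]
        tauto
    · intro S hS
      have hS' := mem_powerset.1 hS
      ext i
      have h1 := @hS' i
      simp only [mem_sdiff, mem_union] at h1 ⊢
      tauto
    · rintro ⟨I, J⟩ hp
      obtain ⟨rfl, rfl⟩ := Prod.mk.injEq .. ▸ (mem_filter.1 hp).2
      congr 1
      · ext i
        simp only [mem_sdiff, mem_union, mem_inter]
        tauto
      · ext i
        simp only [mem_sdiff, mem_union, mem_inter]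
        tauto
  · refine sum_eq_zero fun p hp => absurd ?_ hAU
    have := (mem_filter.1 hp).2
    rw [Prod.mk.injEq] at this
    rw [← this.1, ← this.2]
    exact inter_subset_left.trans subset_union_left

end ShiftRep

end Rep

/-! ### The normalized currents -/

section Normalization

/-- The function `b ↦ Λ_{a,b}` is piecewise linear: it rises on `[0, a]` and falls on
`[a, r + 1]`. -/
lemma two_mul_sum_Lam {r a : ℕ} (ha : a ≤ r + 1) :
    2 * ∑ b ∈ Icc 1 r, Lam r a b = (a : ℤ) * ((r : ℤ) + 1 - a) * ((r : ℤ) + 1) := by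
  have h1 : ∀ m ≤ a, 2 * ∑ b ∈ Icc 1 m, Lam r a b = ((r : ℤ) + 1 - a) * m * (m + 1) := by
    intro m
    induction m with
    | zero => simp
    | succ m ih =>
      intro hm
      rw [← insert_Icc_right_eq_Icc_add_one (by omega), sum_insert (by simp), mul_add,
        ih (by omega), Lam, min_eq_right (by exact_mod_cast hm),
        max_eq_left (by exact_mod_cast hm)]
      push_cast
      ring
  have h2 : ∀ m, a ≤ m → 2 * ∑ b ∈ Icc 1 m, Lam r a b = ((r : ℤ) + 1 - a) * a * (a + 1) +
      a * (2 * (r + 1) * (m - a) - m * (m + 1) + a * (a + 1)) := by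
    intro m hm
    induction m, hm using Nat.le_induction with
    | base => rw [h1 a le_rfl]; ring
    | succ m hm ih =>
      rw [← insert_Icc_right_eq_Icc_add_one (by omega), sum_insert (by simp), mul_add,
        ih, Lam, min_eq_left (by exact_mod_cast hm.trans (Nat.le_succ m)),
        max_eq_right (by exact_mod_cast hm.trans (Nat.le_succ m))]
      push_cast
      ring
  -- For `a = r + 1` the sum stops before the maximum; all its terms vanish.
  rcases Nat.le_or_eq_of_le_succ ha with h | h
  · rw [h2 r h]
    ring
  · rw [h1 r (by omega), h]
    push_cast
    ring

end Normalization

section Currents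

variable {r : ℕ} {k : Type*} [Field k] (u : kˣ)

/-- The exponent of `u` in the normalization of `𝒟_{a,n}`, with the sum of the
`Λ_{a,b}` evaluated. -/
def normExp (r a : ℕ) (n : ℤ) : ℤ := -((a : ℤ) * ((r : ℤ) + 1 - a) * (n + (r + 1)))

/-- The coefficient of `D_I` in the current `𝒟_{a,n}`, for `|I| = a`. -/
noncomputable def dCoeff (a : ℕ) (n : ℤ) (I : Finset (Fin (r + 1))) : RatFun r k :=
  uK u ^ normExp r a n * ((∏ i ∈ I, z r k i) ^ n * aCoeff k I)

/-- `∏_{i ∈ I} (1 + u^r X z_i)`. For the full index set, this is the generating polynomial of the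
asserted values of the conserved quantities. -/
noncomputable def linFactor (I : Finset (Fin (r + 1))) : (RatFun r k)[X] :=
  ∏ i ∈ I, (1 + C (uK u ^ r) * X * C (z r k i))

lemma dCoeff_mul_shift_dCoeff (a b : ℕ) (m n : ℤ) {A B S : Finset (Fin (r + 1))}
    (hAB : Disjoint A B) (hS : S ⊆ B) :
    dCoeff u a m (A ∪ S) * shift u (A ∪ S) (dCoeff u b n (A ∪ (B \ S))) =
      uK u ^ (normExp r a m + normExp r b n +
          n * (2 * (#A + #S) * (#A + #(B \ S)) - 2 * ((r : ℤ) + 1) * #A)) *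
        (kappa u A B * (∏ i ∈ A, z r k i) ^ (m + n)) *
        ((∏ i ∈ S, z r k i) ^ (m + #(B \ S)) * (∏ i ∈ B \ S, z r k i) ^ (n + #S)) *
          pairWeight (qK u) (z r k) S (B \ S) := by
  have hAS : Disjoint A S := hAB.mono_right hS
  have hAT : Disjoint A (B \ S) := hAB.mono_right sdiff_subset
  have hint : (A ∪ S) ∩ (A ∪ (B \ S)) = A := by
    ext i
    simp only [mem_inter, mem_union, mem_sdiff]
    tauto
  have hne := prod_z_ne_zero (r := r) (k := k)
  have h := aCoeff_mul_shift_aCoeff (k := k) u hAB hS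
  have hu : shift u (A ∪ S) ((uK u : RatFun r k) ^ normExp r b n) = uK u ^ normExp r b n := by
    rw [map_zpow₀, AlgEquiv.commutes]
  rw [dCoeff, dCoeff, map_mul, map_mul, shift_prod_z_zpow, hint, hu, card_union_of_disjoint hAS,
    card_union_of_disjoint hAT, zpow_add₀ (uK_ne_zero u), zpow_add₀ (uK_ne_zero u),
    zpow_add₀ (hne A), zpow_add₀ (hne S), zpow_add₀ (hne (B \ S)), zpow_natCast, zpow_natCast]
  push_cast
  rw [prod_union hAS, prod_union hAT, mul_zpow, mul_zpow]
  linear_combination (uK u ^ normExp r a m * uK u ^ normExp r b n *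
    uK u ^ (n * (2 * ((#A : ℤ) + #S) * (#A + #(B \ S)) - 2 * ((r : ℤ) + 1) * #A)) *
    (∏ i ∈ A, z r k i) ^ m * (∏ i ∈ A, z r k i) ^ n * (∏ i ∈ S, z r k i) ^ m *
    (∏ i ∈ B \ S, z r k i) ^ n) * h

end Currents

section Rep

variable {r : ℕ} {k : Type*} [Field k] {u : kˣ} {𝓡 : Type*} [Ring 𝓡] (ρ : ShiftRep r k u 𝓡)

namespace ShiftRep

/-- The current `𝒟_{a,n}`. -/
noncomputable def D (a : ℕ) (n : ℤ) : 𝓡 :=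
  ∑ I ∈ powersetCard a univ, ρ.mul (dCoeff u a n I) * ρ.shiftOp I

/-- The current `𝒟_{a,n}` with the coefficient of each `D_I` multiplied on the left by
`∏_{i ∈ I} (1 + u^r X z_i)`. Its constant term is `𝒟_{a,n}`, and its coefficient of `X^a` is
proportional to `𝒟_{a,n+1}`. -/
noncomputable def E (a : ℕ) (n : ℤ) : 𝓡[X] :=
  ∑ I ∈ powersetCard a univ,
    ρ.mulPoly (linFactor u I * C (dCoeff u a n I)) * C (ρ.shiftOp I)

lemma C_D (a : ℕ) (n : ℤ) :
    C (ρ.D a n) = ∑ I ∈ powersetCard a univ,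
      ρ.mulPoly (C (dCoeff u a n I)) * C (ρ.shiftOp I) := by
  simp only [D, map_sum, map_mul, mulPoly_C]

lemma E_mul_C_D (a b : ℕ) (m n : ℤ) :
    ρ.E a m * C (ρ.D b n) = ∑ I, ∑ J,
      ρ.mulPoly (if #I = a ∧ #J = b then
        linFactor u I * C (dCoeff u a m I * shift u I (dCoeff u b n J)) else 0) *
      C (ρ.shiftOp (I ∩ J) * ρ.shiftOp (I ∪ J)) := by
  rw [E, C_D, sum_mul_sum_shiftOp]
  simp only [mem_powersetCard_univ, C_mul, mul_assoc]

lemma C_D_mul_C_D (a b : ℕ) (m n : ℤ) :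
    C (ρ.D a m) * C (ρ.D b n) = ∑ I, ∑ J,
      ρ.mulPoly (if #I = a ∧ #J = b then
        C (dCoeff u a m I * shift u I (dCoeff u b n J)) else 0) *
      C (ρ.shiftOp (I ∩ J) * ρ.shiftOp (I ∪ J)) := by
  rw [C_D, C_D, sum_mul_sum_shiftOp]
  simp only [mem_powersetCard_univ, C_mul]

end ShiftRep

end Rep

section Formal

variable {r : ℕ} {k : Type*} [Field k] (u : kˣ) (σ : Equiv.Perm (Fin (r + 1)))

lemma Dop_eq_D {a : ℕ} (ha : a ≤ r + 1) (n : ℤ) :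
    Dop u σ a n = (formalRep (k := k) u σ).D a n := by
  change _ = ∑ I ∈ powersetCard a univ, mulOpHom r k (dCoeff u a n I) * shiftOp u σ I
  rw [Dop, smul_eq_mulOpHom_mul, mul_sum]
  refine sum_congr rfl fun I _ => ?_
  rw [single_eq_mulOpHom_mul_shiftOp, ← mul_assoc, ← map_mul, dCoeff]
  congr 3
  rw [Units.val_zpow_eq_zpow_val, map_zpow₀, two_mul_sum_Lam ha, Lam, min_self, max_self, normExp]
  congr 1
  ring

end Formal

/-! ### Bilinear identities between the currents -/

section Coordinates

variable {r : ℕ} {k : Type*} [Field k] (u : kˣ)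

lemma z_separated (B : Finset (Fin (r + 1))) : ∀ i ∈ B, ∀ j ∈ B, i ≠ j →
    z r k i ≠ z r k j ∧ z r k i ≠ qK u * z r k j := fun _ _ _ _ hij =>
  ⟨fun h => hij (z_injective r k h), z_ne_algebraMap_mul_z r k hij _⟩

lemma linFactor_union {A S : Finset (Fin (r + 1))} (h : Disjoint A S) :
    (linFactor u (A ∪ S) : (RatFun r k)[X]) = linFactor u A * linFactor u S :=
  prod_union h

lemma linFactor_eq (S : Finset (Fin (r + 1))) : (linFactor u S : (RatFun r k)[X]) =
    ∏ i ∈ S, (1 + C (uK u ^ r) * X * algebraMap (RatFun r k) (RatFun r k)[X] (z r k i)) := rfl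

/-- Two products of powers of `u`, of `x = ∏_{i ∈ S} z_i` and of `y = ∏_{i ∈ T} z_i` agree if the
exponents do. The right-hand side separates the exponents `ζ`, `ν` common to all splittings from
the exponents `Q`, `p`, `q` that appear in the subset-sum identities. -/
lemma zpow_monomial_eq {K : Type*} [Field K] {U x y : K} (hU : U ≠ 0) (hx : x ≠ 0) (hy : y ≠ 0)
    {κ κ' W : K} {c e ζ Q i j ν : ℤ} {p q : ℕ} (hκ : κ = κ') (he : c + e = ζ + Q)
    (hi : i = ν + p) (hj : j = ν + q) :
    U ^ c * (U ^ e * κ * (x ^ i * y ^ j) * W) =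
      U ^ ζ * κ' * (y ^ ν * x ^ ν) * (U ^ Q * (x ^ p * y ^ q) * W) := by
  have h : U ^ c * U ^ e = U ^ ζ * U ^ Q := by rw [← zpow_add₀ hU, he, zpow_add₀ hU]
  rw [hκ, hi, hj, zpow_add₀ hx, zpow_add₀ hy, zpow_natCast, zpow_natCast]
  linear_combination (κ' * (x ^ ν * x ^ p * (y ^ ν * y ^ q)) * W) * h

lemma qK_pow (m : ℕ) : (qK u : RatFun r k) ^ m = uK u ^ (-2 * ((r : ℤ) + 1) * m) := by
  rw [qK_eq, zpow_mul _ _ (m : ℤ), zpow_natCast _ m]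

end Coordinates

namespace ShiftRep

variable {r : ℕ} {k : Type*} [Field k] {u : kˣ} {𝓡 : Type*} [Ring 𝓡] (ρ : ShiftRep r k u 𝓡)

/-- The scalar `u ^ e`. -/
noncomputable def scalar (e : ℤ) : 𝓡 := ρ.mul (uK u ^ e)

/-- The deformation by `X` of the quantum `Q`-system
`𝒟_{a,n}² - 𝒟_{a-1,n} 𝒟_{a+1,n} = v^{Λ_{a,a}} 𝒟_{a,n-1} 𝒟_{a,n+1}`, here with `a + 1` in place
of `a`. -/
lemma E_mul_D_sub (a : ℕ) (n : ℤ) :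
    ρ.E (a + 1) n * C (ρ.D (a + 1) n) - ρ.E a n * C (ρ.D (a + 2) n) =
      C (ρ.scalar (2 * ((a + 1) * (r - a)))) *
        (ρ.E (a + 1) (n - 1) * C (ρ.D (a + 1) (n + 1))) := by
  rw [← sub_eq_zero, scalar, ← mulPoly_C]
  refine Eq.trans ?_ (ρ.sum_mulPoly_mul_shiftOp_eq_zero (fun I J =>
    (if #I = a + 1 ∧ #J = a + 1 then
        linFactor u I * C (dCoeff u (a + 1) n I * shift u I (dCoeff u (a + 1) n J)) else 0) -
      (if #I = a ∧ #J = a + 2 then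
        linFactor u I * C (dCoeff u a n I * shift u I (dCoeff u (a + 2) n J)) else 0) -
      C (uK u ^ (2 * (((a : ℤ) + 1) * (r - a)))) * (if #I = a + 1 ∧ #J = a + 1 then
        linFactor u I * C (dCoeff u (a + 1) (n - 1) I * shift u I (dCoeff u (a + 1) (n + 1) J))
        else 0)) ?_)
  · rw [E_mul_C_D, E_mul_C_D, E_mul_C_D]
    simp only [map_sub, sub_mul, sum_sub_distrib, map_mul ρ.mulPoly, mul_sum, mul_assoc]
  -- The pairs `(I, J) = (A ∪ S, A ∪ T)` with given `A` and `B = S ∪ T`; the sizes of `I` and `J`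
  -- fix `2 |A| + |B|`.
  intro A B hAB
  by_cases hc : 2 * #A + #B = 2 * (a + 1)
  swap
  · refine sum_eq_zero fun S hS => ?_
    have h1 := card_sdiff_add_card_eq_card (mem_powerset.1 hS)
    have hAS : Disjoint A S := hAB.mono_right (mem_powerset.1 hS)
    have hAT : Disjoint A (B \ S) := hAB.mono_right sdiff_subset
    rw [card_union_of_disjoint hAS, card_union_of_disjoint hAT, if_neg (by omega),
      if_neg (by omega), if_neg (by omega)]
    simp
  have key := sum_balancedSummand_eq_zero (R := (RatFun r k)[X]) (qK u) (C (uK u ^ r) * X) (z r k) B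
    (z_separated u B)
  -- The exponents of `u` and of `∏_{i ∈ B} z_i` that all these pairs have in common; what is left
  -- is the subset-sum identity.
  set ζ := 2 * normExp r (a + 1) n + n * (2 * (a + 1) * (a + 1) - 2 * ((r : ℤ) + 1) * #A) +
    2 * ((r : ℤ) + 1) * (a + 1 - #A) with hζ
  set ν := n + ((a : ℤ) + 1 - #A) - 1 with hν
  refine (sum_congr rfl (g := fun S => linFactor u A * C (uK u ^ ζ *
    (kappa u A B * (∏ i ∈ A, z r k i) ^ (n + n)) * (∏ i ∈ B, z r k i) ^ ν) * _)
    fun S hS => ?_).trans ((mul_sum _ _ _).symm.trans (by rw [key, mul_zero]))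
  have hSB := mem_powerset.1 hS
  have h1 := card_sdiff_add_card_eq_card hSB
  have hAS : Disjoint A S := hAB.mono_right hSB
  have hAT : Disjoint A (B \ S) := hAB.mono_right sdiff_subset
  simp only [dCoeff_mul_shift_dCoeff u _ _ _ _ hAB hSB]
  rw [card_union_of_disjoint hAS, card_union_of_disjoint hAT, linFactor_union u hAS,
    ← prod_sdiff hSB, mul_zpow, balancedSummand, ← linFactor_eq]
  have hx := prod_z_ne_zero (k := k) S
  have hy := prod_z_ne_zero (k := k) (B \ S)
  have hU := uK_ne_zero (r := r) u
  simp only [Polynomial.algebraMap_eq, ← map_prod, ← C_pow, qK_pow]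
  set T := B \ S with hT
  set x := ∏ i ∈ S, z r k i
  set y := ∏ i ∈ T, z r k i
  set W := pairWeight (qK u) (z r k) S T
  by_cases hst : #S = #T
  · rw [if_pos (by omega), if_neg (by omega), if_pos (by omega), if_pos hst, if_neg (by omega)]
    have hA : (#A : ℤ) = a + 1 - #S := by omega
    have hT' : (#T : ℤ) = #S := by omega
    have t1 := zpow_monomial_eq hU hx hy (κ := kappa u A B * (∏ i ∈ A, z r k i) ^ (n + n)) (W := W)
      (c := 0) (e := normExp r (a + 1) n + normExp r (a + 1) n + n *
        (2 * (#A + #S) * (#A + #T) - 2 * ((r : ℤ) + 1) * #A)) (ζ := ζ)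
      (Q := -2 * ((r : ℤ) + 1) * #S) (i := n + #T) (j := n + #S) (ν := ν) (p := 1) (q := 1) rfl
      (by rw [hζ, hA, hT']; ring) (by rw [hν, hA, hT']; push_cast; ring)
      (by rw [hν, hA]; push_cast; ring)
    have t3 := zpow_monomial_eq hU hx hy
      (κ := kappa u A B * (∏ i ∈ A, z r k i) ^ (n - 1 + (n + 1))) (W := W)
      (κ' := kappa u A B * (∏ i ∈ A, z r k i) ^ (n + n))
      (c := 2 * (((a : ℤ) + 1) * (r - a))) (e := normExp r (a + 1) (n - 1) +
        normExp r (a + 1) (n + 1) + (n + 1) *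
        (2 * (#A + #S) * (#A + #T) - 2 * ((r : ℤ) + 1) * #A)) (ζ := ζ)
      (Q := 0) (i := n - 1 + #T) (j := n + 1 + #S) (ν := ν) (p := 0) (q := 2)
      (by congr 2; ring)
      (by rw [hζ, hA, hT']; simp only [normExp]; push_cast; ring)
      (by rw [hν, hA, hT']; push_cast; ring) (by rw [hν, hA]; push_cast; ring)
    have t1' := congrArg C t1
    have t3' := congrArg C t3
    simp only [C_mul, C_pow, zpow_zero, C_1] at t1' t3' ⊢
    linear_combination (linFactor u A * linFactor u S) * (t1' - t3')
  · by_cases hst' : #T = #S + 2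
    · rw [if_neg (by omega), if_pos (by omega), if_neg (by omega), if_neg hst, if_pos hst']
      have hA : (#A : ℤ) = a - #S := by omega
      have hT' : (#T : ℤ) = #S + 2 := by omega
      have t2 := zpow_monomial_eq hU hx hy
        (κ := kappa u A B * (∏ i ∈ A, z r k i) ^ (n + n)) (W := W) (c := 0)
        (e := normExp r a n + normExp r (a + 2) n + n *
          (2 * (#A + #S) * (#A + #T) - 2 * ((r : ℤ) + 1) * #A)) (ζ := ζ)
        (Q := -2 * ((r : ℤ) + 1) * #S) (i := n + #T) (j := n + #S) (ν := ν) (p := 2) (q := 0) rfl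
        (by rw [hζ, hA, hT']; simp only [normExp]; push_cast; ring)
        (by rw [hν, hA, hT']; push_cast; ring) (by rw [hν, hA]; push_cast; ring)
      have t2' := congrArg C t2
      simp only [C_mul, C_pow, zpow_zero, C_1] at t2' ⊢
      linear_combination -(linFactor u A * linFactor u S) * t2'
    · rw [if_neg (by omega), if_neg (by omega), if_neg (by omega), if_neg hst, if_neg hst']
      simp only [mul_zero, zero_mul, sub_zero]

/-- The constant term of this identity says that `𝒟_{a,n}` and `𝒟_{a+1,n}` commute; the rest of it
expresses `E_{a+1,n}` through `E_{a,n}` and `E_{a,n-1}`. -/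
lemma E_succ_mul_D_sub (a : ℕ) (n : ℤ) :
    ρ.E (a + 1) n * C (ρ.D a n) - ρ.E a n * C (ρ.D (a + 1) n) =
      C (ρ.scalar (2 * ((a + 1) * (r - a)))) * X *
        (ρ.E a (n - 1) * C (ρ.D (a + 1) (n + 1))) := by
  rw [← sub_eq_zero, scalar, ← mulPoly_C, ← ρ.mulPoly_X]
  refine Eq.trans ?_ (ρ.sum_mulPoly_mul_shiftOp_eq_zero (fun I J =>
    (if #I = a + 1 ∧ #J = a then
        linFactor u I * C (dCoeff u (a + 1) n I * shift u I (dCoeff u a n J)) else 0) -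
      (if #I = a ∧ #J = a + 1 then
        linFactor u I * C (dCoeff u a n I * shift u I (dCoeff u (a + 1) n J)) else 0) -
      C (uK u ^ (2 * (((a : ℤ) + 1) * (r - a)))) * X * (if #I = a ∧ #J = a + 1 then
        linFactor u I * C (dCoeff u a (n - 1) I * shift u I (dCoeff u (a + 1) (n + 1) J))
        else 0)) ?_)
  · rw [E_mul_C_D, E_mul_C_D, E_mul_C_D]
    simp only [map_sub, sub_mul, sum_sub_distrib, map_mul ρ.mulPoly, mul_sum, mul_assoc]
  intro A B hAB
  by_cases hc : 2 * #A + #B = 2 * a + 1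
  swap
  · refine sum_eq_zero fun S hS => ?_
    have h1 := card_sdiff_add_card_eq_card (mem_powerset.1 hS)
    have hAS : Disjoint A S := hAB.mono_right (mem_powerset.1 hS)
    have hAT : Disjoint A (B \ S) := hAB.mono_right sdiff_subset
    rw [card_union_of_disjoint hAS, card_union_of_disjoint hAT, if_neg (by omega),
      if_neg (by omega), if_neg (by omega)]
    simp
  have key := sum_adjacentSummand_eq_zero (R := (RatFun r k)[X]) (qK u) (C (uK u ^ r) * X) (z r k) B
    (z_separated u B)
  set ζ := normExp r (a + 1) n + normExp r a n +
    n * (2 * (a + 1) * a - 2 * ((r : ℤ) + 1) * #A) + 2 * ((r : ℤ) + 1) * (a - #A) with hζ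
  set ν := n + ((a : ℤ) - #A) with hν
  refine (sum_congr rfl (g := fun S => linFactor u A * C (uK u ^ ζ *
    (kappa u A B * (∏ i ∈ A, z r k i) ^ (n + n)) * (∏ i ∈ B, z r k i) ^ ν) * _)
    fun S hS => ?_).trans ((mul_sum _ _ _).symm.trans (by rw [key, mul_zero]))
  have hSB := mem_powerset.1 hS
  have h1 := card_sdiff_add_card_eq_card hSB
  have hAS : Disjoint A S := hAB.mono_right hSB
  have hAT : Disjoint A (B \ S) := hAB.mono_right sdiff_subset
  simp only [dCoeff_mul_shift_dCoeff u _ _ _ _ hAB hSB]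
  rw [card_union_of_disjoint hAS, card_union_of_disjoint hAT, linFactor_union u hAS,
    ← prod_sdiff hSB, mul_zpow, adjacentSummand, ← linFactor_eq]
  have hx := prod_z_ne_zero (k := k) S
  have hy := prod_z_ne_zero (k := k) (B \ S)
  have hU := uK_ne_zero (r := r) u
  simp only [Polynomial.algebraMap_eq, ← map_prod, ← C_pow, qK_pow]
  set T := B \ S with hT
  set x := ∏ i ∈ S, z r k i
  set y := ∏ i ∈ T, z r k i
  set W := pairWeight (qK u) (z r k) S T
  by_cases hst : #S = #T + 1
  · rw [if_pos (by omega), if_neg (by omega), if_neg (by omega), if_pos hst, if_neg (by omega)]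
    have hA : (#A : ℤ) = a - #T := by omega
    have hS' : (#S : ℤ) = #T + 1 := by omega
    have t1 := zpow_monomial_eq hU hx hy (κ := kappa u A B * (∏ i ∈ A, z r k i) ^ (n + n)) (W := W)
      (c := 0) (e := normExp r (a + 1) n + normExp r a n + n *
        (2 * (#A + #S) * (#A + #T) - 2 * ((r : ℤ) + 1) * #A)) (ζ := ζ)
      (Q := -2 * ((r : ℤ) + 1) * #T) (i := n + #T) (j := n + #S) (ν := ν) (p := 0) (q := 1) rfl
      (by rw [hζ, hA, hS']; ring) (by rw [hν, hA]; push_cast; ring)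
      (by rw [hν, hA, hS']; push_cast; ring)
    have t1' := congrArg C t1
    simp only [C_mul, C_pow, zpow_zero, C_1] at t1' ⊢
    linear_combination (linFactor u A * linFactor u S) * t1'
  · by_cases hst' : #T = #S + 1
    · rw [if_neg (by omega), if_pos (by omega), if_pos (by omega), if_neg hst, if_pos hst']
      have hA : (#A : ℤ) = a - #S := by omega
      have hT' : (#T : ℤ) = #S + 1 := by omega
      have t2 := zpow_monomial_eq hU hx hy
        (κ := kappa u A B * (∏ i ∈ A, z r k i) ^ (n + n)) (W := W) (c := 0)
        (e := normExp r a n + normExp r (a + 1) n + n *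
          (2 * (#A + #S) * (#A + #T) - 2 * ((r : ℤ) + 1) * #A)) (ζ := ζ)
        (Q := -2 * ((r : ℤ) + 1) * #S) (i := n + #T) (j := n + #S) (ν := ν) (p := 1) (q := 0) rfl
        (by rw [hζ, hA, hT']; ring)
        (by rw [hν, hA, hT']; push_cast; ring) (by rw [hν, hA]; push_cast; ring)
      have t3 := zpow_monomial_eq hU hx hy
        (κ := kappa u A B * (∏ i ∈ A, z r k i) ^ (n - 1 + (n + 1))) (W := W)
        (κ' := kappa u A B * (∏ i ∈ A, z r k i) ^ (n + n))
        (c := 2 * (((a : ℤ) + 1) * (r - a))) (e := normExp r a (n - 1) +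
          normExp r (a + 1) (n + 1) + (n + 1) *
          (2 * (#A + #S) * (#A + #T) - 2 * ((r : ℤ) + 1) * #A)) (ζ := ζ)
        (Q := r) (i := n - 1 + #T) (j := n + 1 + #S) (ν := ν) (p := 0) (q := 1)
        (by congr 2; ring)
        (by rw [hζ, hA, hT']; simp only [normExp]; push_cast; ring)
        (by rw [hν, hA, hT']; push_cast; ring) (by rw [hν, hA]; push_cast; ring)
      rw [zpow_natCast] at t3
      have t2' := congrArg C t2
      have t3' := congrArg C t3
      simp only [C_mul, C_pow, zpow_zero, C_1] at t2' t3' ⊢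
      linear_combination -(linFactor u A * linFactor u S) * (t2' + X * t3')
    · rw [if_neg (by omega), if_neg (by omega), if_neg (by omega), if_neg hst, if_neg hst']
      simp only [mul_zero, zero_mul, sub_zero]

lemma C_D_succ_mul_C_D (a : ℕ) (n : ℤ) :
    C (ρ.D (a + 1) n) * C (ρ.D a (n + 1)) =
      C (ρ.scalar (-(2 * (a * (r - a))))) * (C (ρ.D a (n + 1)) * C (ρ.D (a + 1) n)) := by
  rw [← sub_eq_zero, scalar, ← mulPoly_C]
  refine Eq.trans ?_ (ρ.sum_mulPoly_mul_shiftOp_eq_zero (fun I J =>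
    (if #I = a + 1 ∧ #J = a then
        C (dCoeff u (a + 1) n I * shift u I (dCoeff u a (n + 1) J)) else 0) -
      C (uK u ^ (-(2 * ((a : ℤ) * (r - a))))) * (if #I = a ∧ #J = a + 1 then
        C (dCoeff u a (n + 1) I * shift u I (dCoeff u (a + 1) n J)) else 0)) ?_)
  · rw [C_D_mul_C_D, C_D_mul_C_D]
    simp only [map_sub, sub_mul, sum_sub_distrib, map_mul ρ.mulPoly, mul_sum, mul_assoc]
  intro A B hAB
  by_cases hc : 2 * #A + #B = 2 * a + 1
  swap
  · refine sum_eq_zero fun S hS => ?_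
    have h1 := card_sdiff_add_card_eq_card (mem_powerset.1 hS)
    have hAS : Disjoint A S := hAB.mono_right (mem_powerset.1 hS)
    have hAT : Disjoint A (B \ S) := hAB.mono_right sdiff_subset
    rw [card_union_of_disjoint hAS, card_union_of_disjoint hAT, if_neg (by omega),
      if_neg (by omega)]
    simp
  have key := sum_commSummand_eq_zero (R := (RatFun r k)[X]) (qK u) (z r k) B (z_separated u B)
  set ζ := normExp r (a + 1) n + normExp r a (n + 1) +
    (n + 1) * (2 * (a + 1) * a - 2 * ((r : ℤ) + 1) * #A) with hζ
  set ν := n + ((a : ℤ) - #A) with hν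
  refine (sum_congr rfl (g := fun S => C (uK u ^ ζ *
    (kappa u A B * (∏ i ∈ A, z r k i) ^ (n + (n + 1))) * (∏ i ∈ B, z r k i) ^ ν) * _)
    fun S hS => ?_).trans ((mul_sum _ _ _).symm.trans (by rw [key, mul_zero]))
  have hSB := mem_powerset.1 hS
  have h1 := card_sdiff_add_card_eq_card hSB
  have hAS : Disjoint A S := hAB.mono_right hSB
  have hAT : Disjoint A (B \ S) := hAB.mono_right sdiff_subset
  simp only [dCoeff_mul_shift_dCoeff u _ _ _ _ hAB hSB]
  rw [card_union_of_disjoint hAS, card_union_of_disjoint hAT,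
    ← prod_sdiff hSB, mul_zpow, commSummand]
  have hx := prod_z_ne_zero (k := k) S
  have hy := prod_z_ne_zero (k := k) (B \ S)
  have hU := uK_ne_zero (r := r) u
  simp only [Polynomial.algebraMap_eq, ← map_prod, ← C_pow, qK_pow]
  set T := B \ S with hT
  set x := ∏ i ∈ S, z r k i
  set y := ∏ i ∈ T, z r k i
  set W := pairWeight (qK u) (z r k) S T
  by_cases hst : #S = #T + 1
  · rw [if_pos (by omega), if_neg (by omega), if_pos hst, if_neg (by omega)]
    have hA : (#A : ℤ) = a - #T := by omega
    have hS' : (#S : ℤ) = #T + 1 := by omega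
    have t1 := zpow_monomial_eq hU hx hy (κ := kappa u A B * (∏ i ∈ A, z r k i) ^ (n + (n + 1)))
      (W := W) (c := 0) (e := normExp r (a + 1) n + normExp r a (n + 1) + (n + 1) *
        (2 * (#A + #S) * (#A + #T) - 2 * ((r : ℤ) + 1) * #A)) (ζ := ζ)
      (Q := 0) (i := n + #T) (j := n + 1 + #S) (ν := ν) (p := 0) (q := 2) rfl
      (by rw [hζ, hA, hS']; ring) (by rw [hν, hA]; push_cast; ring)
      (by rw [hν, hA, hS']; push_cast; ring)
    have t1' := congrArg C t1
    simp only [C_mul, C_pow, zpow_zero, C_1] at t1' ⊢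
    linear_combination t1'
  · by_cases hst' : #T = #S + 1
    · rw [if_neg (by omega), if_pos (by omega), if_neg hst, if_pos hst']
      have hA : (#A : ℤ) = a - #S := by omega
      have hT' : (#T : ℤ) = #S + 1 := by omega
      have t2 := zpow_monomial_eq hU hx hy
        (κ := kappa u A B * (∏ i ∈ A, z r k i) ^ (n + 1 + n)) (W := W)
        (κ' := kappa u A B * (∏ i ∈ A, z r k i) ^ (n + (n + 1)))
        (c := -(2 * ((a : ℤ) * (r - a)))) (e := normExp r a (n + 1) +
          normExp r (a + 1) n + n *
          (2 * (#A + #S) * (#A + #T) - 2 * ((r : ℤ) + 1) * #A)) (ζ := ζ)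
        (Q := -2 * ((r : ℤ) + 1) * #S) (i := n + 1 + #T) (j := n + #S) (ν := ν) (p := 2) (q := 0)
        (by congr 2; ring)
        (by rw [hζ, hA, hT']; ring)
        (by rw [hν, hA, hT']; push_cast; ring) (by rw [hν, hA]; push_cast; ring)
      have t2' := congrArg C t2
      simp only [C_mul, C_pow] at t2' ⊢
      linear_combination -t2'
    · rw [if_neg (by omega), if_neg (by omega), if_neg hst, if_neg hst']
      simp only [mul_zero, zero_mul, sub_zero]

end ShiftRep

/-! ### Commutation relations between the currents -/

section Coordinates

variable {r : ℕ} {k : Type*} [Field k] (u : kˣ)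

lemma natDegree_linFactor_le (I : Finset (Fin (r + 1))) :
    (linFactor u I : (RatFun r k)[X]).natDegree ≤ #I := by
  rw [← one_mul #I]
  refine natDegree_prod_le_mul_card 1 _ _ fun i _ => ?_
  compute_degree

lemma coeff_zero_linFactor (I : Finset (Fin (r + 1))) :
    (linFactor u I : (RatFun r k)[X]).coeff 0 = 1 := by
  rw [linFactor, coeff_zero_eq_eval_zero, eval_prod]
  simp

lemma coeff_card_linFactor (I : Finset (Fin (r + 1))) :
    (linFactor u I : (RatFun r k)[X]).coeff #I = uK u ^ ((r : ℤ) * #I) * ∏ i ∈ I, z r k i := by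
  have h := coeff_prod_of_natDegree_le (s := I)
    (fun i => (1 + C (uK u ^ r) * X * C (z r k i) : (RatFun r k)[X])) 1
    (fun i _ => by compute_degree)
  rw [mul_one] at h
  rw [linFactor, h]
  rw [zpow_mul, zpow_natCast, zpow_natCast, ← prod_const, ← prod_mul_distrib]
  refine prod_congr rfl fun i _ => ?_
  rw [coeff_add, coeff_mul_C, coeff_C_mul_X]
  simp [coeff_one]

end Coordinates

namespace ShiftRep

variable {r : ℕ} {k : Type*} [Field k] {u : kˣ} {𝓡 : Type*} [Ring 𝓡] (ρ : ShiftRep r k u 𝓡)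

lemma scalar_mul_scalar (e f : ℤ) : ρ.scalar e * ρ.scalar f = ρ.scalar (e + f) := by
  rw [scalar, scalar, scalar, ← map_mul, zpow_add₀ (uK_ne_zero u)]

lemma scalar_zero : ρ.scalar 0 = 1 := by simp [scalar]

lemma scalar_cancel (e : ℤ) {x y : 𝓡} (h : ρ.scalar e * x = ρ.scalar e * y) : x = y := by
  have h' := congrArg (ρ.scalar (-e) * ·) h
  simpa only [← mul_assoc, scalar_mul_scalar, neg_add_cancel, scalar_zero, one_mul] using h'

lemma commute_scalar_mul (e : ℤ) (f : RatFun r k) : Commute (ρ.scalar e) (ρ.mul f) :=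
  (Commute.all _ _).map ρ.mul

lemma commute_scalar_shiftOp (e : ℤ) (I : Finset (Fin (r + 1))) :
    Commute (ρ.scalar e) (ρ.shiftOp I) := by
  rw [Commute, SemiconjBy, scalar, ρ.shiftOp_mul_mul, map_zpow₀ (shift u I), AlgEquiv.commutes]

lemma commute_scalar_D (e : ℤ) (a : ℕ) (n : ℤ) : Commute (ρ.scalar e) (ρ.D a n) :=
  Commute.sum_right _ _ _ fun _ _ =>
    (ρ.commute_scalar_mul e _).mul_right (ρ.commute_scalar_shiftOp e _)

lemma commute_scalar_E (e : ℤ) (a : ℕ) (n : ℤ) : Commute (C (ρ.scalar e)) (ρ.E a n) := by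
  refine Commute.sum_right _ _ _ fun I _ => Commute.mul_right ?_ ?_
  · rw [scalar, ← mulPoly_C]
    exact (Commute.all _ _).map ρ.mulPoly
  · exact (ρ.commute_scalar_shiftOp e I).map C

lemma coeff_E (a : ℕ) (n : ℤ) (m : ℕ) : (ρ.E a n).coeff m = ∑ I ∈ powersetCard a univ,
    ρ.mul ((linFactor u I).coeff m * dCoeff u a n I) * ρ.shiftOp I := by
  simp only [E, finsetSum_coeff, coeff_mul_C, mulPoly, coe_mapRingHom, coeff_map]

lemma coeff_zero_E (a : ℕ) (n : ℤ) : (ρ.E a n).coeff 0 = ρ.D a n := by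
  simp only [coeff_E, coeff_zero_linFactor, one_mul, D]

lemma coeff_E_of_lt {a m : ℕ} (n : ℤ) (h : a < m) : (ρ.E a n).coeff m = 0 := by
  rw [coeff_E]
  refine sum_eq_zero fun I hI => ?_
  rw [mem_powersetCard_univ] at hI
  rw [coeff_eq_zero_of_natDegree_lt ((natDegree_linFactor_le u I).trans_lt (by omega)), zero_mul,
    map_zero, zero_mul]

lemma coeff_self_E (a : ℕ) (n : ℤ) :
    (ρ.E a n).coeff a = ρ.scalar (a * r + a * (r + 1 - a)) * ρ.D a (n + 1) := by
  rw [coeff_E, D, mul_sum]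
  refine sum_congr rfl fun I hI => ?_
  rw [mem_powersetCard_univ] at hI
  subst hI
  rw [coeff_card_linFactor, scalar, ← mul_assoc, ← map_mul, dCoeff, dCoeff,
    zpow_add_one₀ (prod_z_ne_zero I)]
  congr 2
  have h : (uK u : RatFun r k) ^ ((r : ℤ) * #I) * uK u ^ normExp r #I n =
      uK u ^ ((#I : ℤ) * r + #I * (r + 1 - #I)) * uK u ^ normExp r #I (n + 1) := by
    rw [← zpow_add₀ (uK_ne_zero u), ← zpow_add₀ (uK_ne_zero u)]
    congr 1
    simp only [normExp]
    ring
  linear_combination ((∏ i ∈ I, z r k i) * (∏ i ∈ I, z r k i) ^ n * aCoeff k I) * h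

lemma aCoeff_empty : aCoeff k (∅ : Finset (Fin (r + 1))) = 1 := by simp [aCoeff]

lemma aCoeff_univ : aCoeff k (univ : Finset (Fin (r + 1))) = 1 := by simp [aCoeff]

lemma D_top (n : ℤ) : ρ.D (r + 1) n = 1 := by
  have h : powersetCard (r + 1) (univ : Finset (Fin (r + 1))) = {univ} := by
    simpa using powersetCard_self (univ : Finset (Fin (r + 1)))
  rw [D, h, sum_singleton, dCoeff, prod_z, aCoeff_univ, ρ.shiftOp_univ]
  simp [normExp]

lemma E_top (n : ℤ) : ρ.E (r + 1) n = ρ.mulPoly (linFactor u univ) := by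
  have h : powersetCard (r + 1) (univ : Finset (Fin (r + 1))) = {univ} := by
    simpa using powersetCard_self (univ : Finset (Fin (r + 1)))
  rw [E, h, sum_singleton, dCoeff, prod_z, aCoeff_univ, ρ.shiftOp_univ]
  simp [normExp]

lemma D_zero (n : ℤ) : ρ.D 0 n = 1 := by
  simp [D, dCoeff, aCoeff_empty, ρ.shiftOp_empty, normExp]

lemma E_zero (n : ℤ) : ρ.E 0 n = 1 := by
  simp [E, dCoeff, aCoeff_empty, ρ.shiftOp_empty, normExp, linFactor]

lemma D_succ_mul_D (a : ℕ) (n : ℤ) : ρ.D (a + 1) n * ρ.D a n = ρ.D a n * ρ.D (a + 1) n := by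
  have h := congrArg (fun p => p.coeff 0) (ρ.E_succ_mul_D_sub a n)
  simp only [coeff_sub, coeff_mul_C, coeff_zero_E, mul_assoc, coeff_C_mul, coeff_X_mul_zero,
    mul_zero] at h
  exact sub_eq_zero.1 h

lemma D_add_one_mul_D (a : ℕ) (n : ℤ) : ρ.D (a + 1) (n + 1) * ρ.D (a + 1) n =
    ρ.scalar (2 * ((a + 1) * (r - a))) * (ρ.D (a + 1) n * ρ.D (a + 1) (n + 1)) := by
  have h := congrArg (fun p => p.coeff (a + 1)) (ρ.E_mul_D_sub a n)
  simp only [coeff_sub, coeff_mul_C, coeff_C_mul, coeff_self_E,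
    ρ.coeff_E_of_lt n (Nat.lt_succ_self a), zero_mul, sub_zero, sub_add_cancel] at h
  refine ρ.scalar_cancel (↑(a + 1) * r + ↑(a + 1) * (r + 1 - ↑(a + 1))) ?_
  rw [← mul_assoc, h, ← mul_assoc, ← mul_assoc, ← mul_assoc, ← mul_assoc,
    ρ.scalar_mul_scalar, ρ.scalar_mul_scalar, add_comm, mul_assoc]

lemma D_succ_add_one_mul_D (a : ℕ) (n : ℤ) : ρ.D (a + 1) (n + 1) * ρ.D a n =
    ρ.scalar (2 * (a * (r - a))) * (ρ.D a n * ρ.D (a + 1) (n + 1)) := by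
  have h := congrArg (fun p => p.coeff (a + 1)) (ρ.E_succ_mul_D_sub a n)
  simp only [coeff_sub, coeff_mul_C, mul_assoc, coeff_C_mul, coeff_X_mul, coeff_self_E,
    ρ.coeff_E_of_lt n (Nat.lt_succ_self a), zero_mul, sub_zero, sub_add_cancel] at h
  refine ρ.scalar_cancel _ (h.trans ?_)
  rw [← mul_assoc, ← mul_assoc (ρ.scalar _) (ρ.scalar _), ρ.scalar_mul_scalar,
    ρ.scalar_mul_scalar]
  congr 2
  push_cast
  ring

lemma D_add_one_mul_D_succ (a : ℕ) (n : ℤ) : ρ.D a (n + 1) * ρ.D (a + 1) n =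
    ρ.scalar (2 * (a * (r - a))) * (ρ.D (a + 1) n * ρ.D a (n + 1)) := by
  have h := ρ.C_D_succ_mul_C_D a n
  simp only [← C_mul] at h
  rw [C_injective h, ← mul_assoc, ρ.scalar_mul_scalar, add_neg_cancel, ρ.scalar_zero, one_mul]

end ShiftRep

/-- Elements `d₀`, `d₁` and `e₀`, `e₁` that commute up to the scalars `s₁₁`, `s₁₂`, `s₂₂`; in the
application they are `𝒟_{a,n}`, `𝒟_{a+1,n}` and `𝒟_{a,n+1}`, `𝒟_{a+1,n+1}`. -/
lemma units_mul_inv_identity {𝓡 : Type*} [Ring 𝓡] {s₁₁ s₁₂ s₂₂ : 𝓡} (d₀ d₁ e₀ e₁ : 𝓡ˣ)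
    (hs₁₁ : ∀ d ∈ ({d₀, d₁, e₀} : Set 𝓡ˣ), Commute s₁₁ (d : 𝓡))
    (hs₁₂ : ∀ d ∈ ({d₀, d₁, e₀} : Set 𝓡ˣ), Commute s₁₂ (d : 𝓡))
    (hs₂₂ : ∀ d ∈ ({d₀, d₁, e₀} : Set 𝓡ˣ), Commute s₂₂ (d : 𝓡))
    (hs : Commute s₁₁ s₁₂) (hs' : Commute s₁₁ s₂₂)
    (h₁₁ : (e₀ * d₀ : 𝓡) = s₁₁ * (d₀ * e₀)) (h₁₂ : (e₀ * d₁ : 𝓡) = s₁₂ * (d₁ * e₀))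
    (h₁₂' : (e₁ * d₀ : 𝓡) = s₁₂ * (d₀ * e₁)) (h₂₂ : (e₁ * d₁ : 𝓡) = s₂₂ * (d₁ * e₁)) :
    s₁₁ * (e₀ * ↑d₀⁻¹ * ↑d₁⁻¹ * ↑e₀⁻¹ * (e₁ * d₁ * d₀)) = s₂₂ * e₁ := by
  have a : (e₁ * d₁ * d₀ : 𝓡) = s₂₂ * (s₁₂ * (d₁ * d₀ * e₁)) := by
    rw [h₂₂, mul_assoc, mul_assoc, h₁₂', ← mul_assoc (d₁ : 𝓡), ← (hs₁₂ d₁ (by simp)).eq]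
    simp only [mul_assoc]
  have b : s₁₁ * (s₁₂ * (d₁ * d₀)) = e₀ * (d₁ * d₀) * ↑e₀⁻¹ := by
    rw [Units.eq_mul_inv_iff_mul_eq]
    calc s₁₁ * (s₁₂ * (d₁ * d₀)) * e₀ = s₁₂ * (s₁₁ * d₁ * (d₀ * e₀)) := by
          rw [← mul_assoc s₁₁, hs.eq]
          simp only [mul_assoc]
      _ = s₁₂ * (d₁ * (e₀ * d₀)) := by
          rw [(hs₁₁ d₁ (by simp)).eq, mul_assoc, ← h₁₁]
      _ = e₀ * (d₁ * d₀) := by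
          rw [← mul_assoc (e₀ : 𝓡), h₁₂]
          simp only [mul_assoc]
  set G : 𝓡ˣ := e₀ * d₀⁻¹ * d₁⁻¹ * e₀⁻¹ with hG
  have hcomm : ∀ s : 𝓡, (∀ d ∈ ({d₀, d₁, e₀} : Set 𝓡ˣ), Commute s (d : 𝓡)) →
      Commute s (G : 𝓡) := by
    intro s h
    simp only [hG, Units.val_mul]
    exact (((h e₀ (by simp)).mul_right (h d₀ (by simp)).units_inv_right).mul_right
      (h d₁ (by simp)).units_inv_right).mul_right (h e₀ (by simp)).units_inv_right
  have hG' : (e₀ * ↑d₀⁻¹ * ↑d₁⁻¹ * ↑e₀⁻¹ : 𝓡) = G := by simp [hG]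
  calc s₁₁ * (e₀ * ↑d₀⁻¹ * ↑d₁⁻¹ * ↑e₀⁻¹ * (e₁ * d₁ * d₀))
      = s₁₁ * ((G * s₂₂) * (s₁₂ * (d₁ * d₀ * e₁))) := by
        rw [hG', a]
        simp only [mul_assoc]
    _ = s₂₂ * (s₁₁ * ((G * s₁₂) * (d₁ * d₀ * e₁))) := by
        rw [← (hcomm _ hs₂₂).eq, mul_assoc s₂₂, ← mul_assoc s₁₁, hs'.eq]
        simp only [mul_assoc]
    _ = s₂₂ * ((G * s₁₁) * (s₁₂ * (d₁ * d₀)) * e₁) := by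
        rw [← (hcomm _ hs₁₂).eq, ← (hcomm _ hs₁₁).eq, mul_assoc s₁₂, ← mul_assoc s₁₁, hs.eq,
          mul_assoc s₁₁, ← mul_assoc (G : 𝓡) s₁₂, ← (hcomm _ hs₁₂).eq,
          ← mul_assoc s₁₁, ← mul_assoc s₁₁, hs.eq]
        simp only [mul_assoc]
    _ = s₂₂ * e₁ := by
        rw [mul_assoc (G : 𝓡), b]
        simp [hG, mul_assoc]

/-! ### Hard particle configurations -/

section HardParticles

/-- The condition on hard particle configurations: an odd element keeps distance two, and an even
element distance three, from the next larger one. -/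
def IsHard (S : Finset ℕ) : Prop :=
  ∀ i ∈ S, ∀ j ∈ S, i < j → (Odd i → i + 1 < j) ∧ (Even i → i + 2 < j)

lemma isHard_insert_odd {b : ℕ} {S : Finset ℕ} (hS : S ⊆ Icc 1 (2 * b + 1)) :
    IsHard (insert (2 * b + 3) S) ↔ IsHard S := by
  refine ⟨fun h i hi j hj => h i (mem_insert_of_mem hi) j (mem_insert_of_mem hj),
    fun h i hi j hj hij => ?_⟩
  have hle : ∀ i ∈ S, i ≤ 2 * b + 1 := fun i hi => (mem_Icc.1 (hS hi)).2
  rcases mem_insert.1 hi with rfl | hi <;> rcases mem_insert.1 hj with rfl | hj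
  · omega
  · have := hle j hj
    omega
  · have := hle i hi
    refine ⟨fun _ => by omega, fun he => ?_⟩
    obtain ⟨c, rfl⟩ := he
    omega
  · exact h i hi j hj hij

lemma isHard_insert_even {b : ℕ} {S : Finset ℕ} (hS : S ⊆ Icc 1 (2 * b + 1)) :
    IsHard (insert (2 * b + 2) S) ↔ IsHard S ∧ S ⊆ Icc 1 (2 * b - 1) := by
  have hle : ∀ i ∈ S, 1 ≤ i ∧ i ≤ 2 * b + 1 := fun i hi => mem_Icc.1 (hS hi)
  constructor
  · refine fun h => ⟨fun i hi j hj => h i (mem_insert_of_mem hi) j (mem_insert_of_mem hj),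
      fun i hi => mem_Icc.2 ⟨(hle i hi).1, ?_⟩⟩
    have h1 := h i (mem_insert_of_mem hi) _ (mem_insert_self _ _) (by have := hle i hi; omega)
    rcases Nat.even_or_odd i with he | ho
    · have := h1.2 he
      omega
    · have := h1.1 ho
      obtain ⟨c, rfl⟩ := ho
      omega
  · rintro ⟨h, hS'⟩ i hi j hj hij
    have hle' : ∀ i ∈ S, 1 ≤ i ∧ i ≤ 2 * b - 1 := fun i hi => mem_Icc.1 (hS' hi)
    rcases mem_insert.1 hi with rfl | hi <;> rcases mem_insert.1 hj with rfl | hj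
    · omega
    · have := hle j hj
      omega
    · have := hle' i hi
      refine ⟨fun _ => by omega, fun he => ?_⟩
      obtain ⟨c, rfl⟩ := he
      omega
    · exact h i hi j hj hij

lemma not_isHard_insert_insert {b : ℕ} {S : Finset ℕ} :
    ¬ IsHard (insert (2 * b + 3) (insert (2 * b + 2) S)) := fun h => by
  have h1 := (h (2 * b + 2) (by simp) (2 * b + 3) (by simp) (by omega)).2 ⟨b + 1, by ring⟩
  omega

lemma sort_insert_of_forall_lt {S : Finset ℕ} {m : ℕ} (h : ∀ i ∈ S, i < m) :
    (insert m S).sort (· ≤ ·) = S.sort (· ≤ ·) ++ [m] := by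
  have h1 : (S.sort (· ≤ ·) ++ [m]).toFinset = insert m S := by
    ext i
    simp
  rw [← h1]
  refine (List.toFinset_sort _ ?_).2 ?_
  · rw [List.nodup_append]
    refine ⟨sort_nodup _ _, List.nodup_singleton _, fun i hi j hj => ?_⟩
    rw [List.mem_singleton.1 hj]
    exact (h i ((mem_sort _).1 hi)).ne
  · rw [List.pairwise_append]
    refine ⟨pairwise_sort _ _, List.pairwise_singleton _ _, fun i hi j hj => ?_⟩
    rw [List.mem_singleton.1 hj]
    exact (h i ((mem_sort _).1 hi)).le

variable {𝓡 : Type*} [Ring 𝓡] (Y : ℕ → 𝓡)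

open Classical in
/-- The term `X^|S| Y_{i₁} ⋯ Y_{i_m}` of `S = {i₁ < ⋯ < i_m}`, or zero if `S` is not a hard particle
configuration. -/
noncomputable def hardWeight (S : Finset ℕ) : 𝓡[X] :=
  if IsHard S then C ((S.sort (· ≤ ·)).map Y).prod * X ^ #S else 0

/-- The generating polynomial of the hard particle configurations in `[1, M]`. -/
noncomputable def hardPoly (M : ℕ) : 𝓡[X] := ∑ S ∈ (Icc 1 M).powerset, hardWeight Y S

lemma hardPoly_zero : hardPoly Y 0 = 1 := by
  simp [hardPoly, hardWeight, IsHard]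

lemma hardWeight_insert {S : Finset ℕ} {m : ℕ} (h : ∀ i ∈ S, i < m) (hard : IsHard (insert m S))
    (hard' : IsHard S) : hardWeight Y (insert m S) = hardWeight Y S * (X * C (Y m)) := by
  rw [hardWeight, hardWeight, if_pos hard, if_pos hard', sort_insert_of_forall_lt h,
    card_insert_of_notMem fun hm => (h m hm).false]
  simp only [List.map_append, List.prod_append, List.map_singleton, List.prod_singleton, C_mul]
  rw [X_mul, mul_assoc, mul_assoc, X_pow_mul, mul_assoc, pow_succ']

lemma hardPoly_one : hardPoly Y 1 = 1 + X * C (Y 1) := by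
  have h0 : IsHard ∅ := by simp [IsHard]
  have h1 : IsHard {1} := by simp [IsHard]
  rw [hardPoly, Icc_self, ← insert_empty_eq, sum_powerset_insert (notMem_empty 1)]
  simp only [powerset_empty, sum_singleton]
  rw [hardWeight_insert Y (by simp) (by simpa using h1) h0]
  simp [hardWeight, h0]

/-- The configurations in `[1, 2b+3]` have at most one of the elements `2b+2` and `2b+3`. The
element `2b+3` can be added to all those in `[1, 2b+1]`, and `2b+2` to those in `[1, 2b-1]`. For
`b = 0`, the truncated `2b-1` is `0`, as it should be. -/
lemma hardPoly_add_three (b : ℕ) : hardPoly Y (2 * b + 3) =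
    hardPoly Y (2 * b + 1) * (1 + X * C (Y (2 * b + 3))) +
      hardPoly Y (2 * b - 1) * (X * C (Y (2 * b + 2))) := by
  classical
  have hI : Icc 1 (2 * b + 3) = insert (2 * b + 3) (insert (2 * b + 2) (Icc 1 (2 * b + 1))) := by
    ext i
    simp only [mem_insert, mem_Icc]
    omega
  rw [hardPoly, hI, sum_powerset_insert (by simp), sum_powerset_insert (by simp),
    sum_powerset_insert (by simp), ← hardPoly]
  have h4 : ∑ S ∈ (Icc 1 (2 * b + 1)).powerset,
      hardWeight Y (insert (2 * b + 3) (insert (2 * b + 2) S)) = 0 :=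
    sum_eq_zero fun S _ => if_neg not_isHard_insert_insert
  have h3 : ∑ S ∈ (Icc 1 (2 * b + 1)).powerset, hardWeight Y (insert (2 * b + 3) S) =
      hardPoly Y (2 * b + 1) * (X * C (Y (2 * b + 3))) := by
    rw [hardPoly, sum_mul]
    refine sum_congr rfl fun S hS => ?_
    have hS' := mem_powerset.1 hS
    by_cases h : IsHard S
    · exact hardWeight_insert Y (fun i hi => by have := mem_Icc.1 (hS' hi); omega)
        ((isHard_insert_odd hS').2 h) h
    · rw [hardWeight, if_neg (fun h' => h ((isHard_insert_odd hS').1 h')), hardWeight, if_neg h,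
        zero_mul]
  have h2 : ∑ S ∈ (Icc 1 (2 * b + 1)).powerset, hardWeight Y (insert (2 * b + 2) S) =
      hardPoly Y (2 * b - 1) * (X * C (Y (2 * b + 2))) := by
    have hsub : Icc 1 (2 * b - 1) ⊆ Icc 1 (2 * b + 1) := Icc_subset_Icc_right (by omega)
    rw [hardPoly, sum_mul, ← sum_subset (powerset_mono.2 hsub)]
    · refine sum_congr rfl fun S hS => ?_
      have hS' := mem_powerset.1 hS
      by_cases h : IsHard S
      · exact hardWeight_insert Y (fun i hi => by have := mem_Icc.1 (hS' hi); omega)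
          ((isHard_insert_even (hS'.trans hsub)).2 ⟨h, hS'⟩) h
      · rw [hardWeight, if_neg (fun h' => h ((isHard_insert_even (hS'.trans hsub)).1 h').1),
          hardWeight, if_neg h, zero_mul]
    · intro S hS hS'
      exact if_neg fun h => hS' (mem_powerset.2 ((isHard_insert_even (mem_powerset.1 hS)).1 h).2)
  rw [h4, h3, h2, add_zero, mul_add, mul_one, add_right_comm]

lemma coeff_hardPoly (r m : ℕ) : (hardPoly Y (2 * r + 1)).coeff m =
    ∑ S ∈ hardParticle r m, ((S.sort (· ≤ ·)).map Y).prod := by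
  classical
  have h : hardParticle r m = {S ∈ (Icc 1 (2 * r + 1)).powerset | IsHard S ∧ #S = m} := by
    ext S
    simp only [hardParticle, mem_filter, mem_powersetCard, mem_powerset]
    simp only [IsHard]
    tauto
  rw [h, sum_filter, hardPoly, finsetSum_coeff]
  refine sum_congr rfl fun S _ => ?_
  rw [hardWeight]
  by_cases hS : IsHard S
  · simp only [hS, if_true, true_and, coeff_C_mul, coeff_X_pow]
    by_cases hm : #S = m
    · simp [hm]
    · simp [hm, Ne.symm hm]
  · simp [hS]

end HardParticles

/-! ### The generating polynomial of the conserved quantities -/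

/-- The division by `d₁` of the recursion for the generating polynomials: `h'` expresses `G` through
`p'` and an auxiliary `F`, and `h` expresses `F` through `p` and `p'`; the scalars that arise in the
elimination of `F` match by `key`. -/
lemma add_mul_C_eq_of_mul_C_sub {𝓡 : Type*} [Ring 𝓡] {s s' c : 𝓡} (d₀ d₁ e₀ e₁ : 𝓡ˣ)
    {p p' F G : 𝓡[X]} (hd : (d₁ * d₀ : 𝓡) = d₀ * d₁)
    (key : s * (e₀ * ↑d₀⁻¹ * ↑d₁⁻¹ * ↑e₀⁻¹ * (e₁ * d₁ * d₀)) = s' * e₁)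
    (hs : Commute (C s) F) (hs' : Commute (C s') F)
    (h : p' * C (d₀ : 𝓡) * C (d₀ : 𝓡) - p * C c * C (d₁ : 𝓡) = C s * (F * C (e₀ : 𝓡)))
    (h' : G * C (d₀ : 𝓡) - p' * C (d₀ : 𝓡) * C (d₁ : 𝓡) = C s' * X * (F * C (e₁ : 𝓡))) :
    (p' * (1 + X * C (d₀ * ↑d₁⁻¹ * ↑e₀⁻¹ * e₁ : 𝓡)) +
      p * (X * C (-(c * ↑d₀⁻¹ * ↑e₀⁻¹ * e₁ : 𝓡)))) * C (d₁ : 𝓡) = G := by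
  have hdd : (d₁ * ↑d₀⁻¹ * ↑d₁⁻¹ : 𝓡) = ↑d₀⁻¹ := by
    rw [Units.mul_inv_eq_iff_eq_mul, Units.mul_inv_eq_iff_eq_mul, mul_assoc, hd,
      Units.inv_mul_cancel_left]
  obtain ⟨V, hV⟩ : ∃ V : 𝓡, V = ↑d₀⁻¹ * ↑d₁⁻¹ * ↑e₀⁻¹ * (e₁ * d₁ * d₀) := ⟨_, rfl⟩
  have e1 : (d₀ * ↑d₁⁻¹ * ↑e₀⁻¹ * e₁ * d₁ * d₀ : 𝓡) = d₀ * d₀ * V := by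
    simp [hV, mul_assoc]
  have e2 : (c * ↑d₀⁻¹ * ↑e₀⁻¹ * e₁ * d₁ * d₀ : 𝓡) = c * d₁ * V :=
    calc (c * ↑d₀⁻¹ * ↑e₀⁻¹ * e₁ * d₁ * d₀ : 𝓡)
        = c * (d₁ * ↑d₀⁻¹ * ↑d₁⁻¹ : 𝓡) * ↑e₀⁻¹ * e₁ * d₁ * d₀ := by rw [hdd]
      _ = c * d₁ * V := by simp only [hV, mul_assoc]
  have key' : s * (e₀ * V) = s' * e₁ := by
    rw [← key, hV]
    simp only [mul_assoc]
  have hunit : IsUnit (C (d₀ : 𝓡)) := d₀.isUnit.map C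
  refine hunit.mul_right_cancel ?_
  calc (p' * (1 + X * C (d₀ * ↑d₁⁻¹ * ↑e₀⁻¹ * e₁ : 𝓡)) +
        p * (X * C (-(c * ↑d₀⁻¹ * ↑e₀⁻¹ * e₁ : 𝓡)))) * C (d₁ : 𝓡) * C (d₀ : 𝓡)
      = p' * C (d₁ * d₀ : 𝓡) + X * (p' * C (d₀ * ↑d₁⁻¹ * ↑e₀⁻¹ * e₁ * d₁ * d₀ : 𝓡) -
          p * C (c * ↑d₀⁻¹ * ↑e₀⁻¹ * e₁ * d₁ * d₀ : 𝓡)) := by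
        rw [mul_sub, ← mul_assoc X, ← mul_assoc X, X_mul (p := p'), X_mul (p := p)]
        simp only [C_neg, C_mul, mul_add, add_mul, mul_neg, neg_mul, mul_one, mul_assoc]
        abel
    _ = p' * C (d₁ * d₀ : 𝓡) + X * ((p' * C (d₀ : 𝓡) * C (d₀ : 𝓡) - p * C c * C (d₁ : 𝓡)) *
          C V) := by
        rw [e1, e2]
        simp only [C_mul, sub_mul, mul_assoc]
    _ = p' * C (d₁ * d₀ : 𝓡) + X * (F * C (s * (e₀ * V))) := by
        rw [h, ← mul_assoc (C _) F, hs.eq]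
        simp only [C_mul, mul_assoc]
    _ = p' * C (d₁ * d₀ : 𝓡) + X * (C s' * (F * C (e₁ : 𝓡))) := by
        rw [key', C_mul (a := s'), ← mul_assoc F, ← hs'.eq, mul_assoc]
    _ = G * C (d₀ : 𝓡) := by
        rw [← mul_assoc X, X_mul, ← h', hd, C_mul, ← mul_assoc p', add_sub_cancel]

namespace ShiftRep

variable {r : ℕ} {k : Type*} [Field k] {u : kˣ} {𝓡 : Type*} [Ring 𝓡] (ρ : ShiftRep r k u 𝓡)

/-- The weights `𝒴_i(n)`. The inverse is the junk value `0` unless the current is a unit, which is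
an assumption wherever it matters. -/
noncomputable def Y (n : ℤ) (i : ℕ) : 𝓡 :=
  if Even i then
    -(ρ.D (i / 2 - 1) n * Ring.inverse (ρ.D (i / 2) n) * Ring.inverse (ρ.D (i / 2) (n + 1)) *
      ρ.D (i / 2 + 1) (n + 1))
  else ρ.D ((i + 1) / 2 - 1) n * Ring.inverse (ρ.D ((i + 1) / 2) n) *
    Ring.inverse (ρ.D ((i + 1) / 2 - 1) (n + 1)) * ρ.D ((i + 1) / 2) (n + 1)

lemma Y_even (n : ℤ) (b : ℕ) : ρ.Y n (2 * b + 2) = -(ρ.D b n * Ring.inverse (ρ.D (b + 1) n) *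
    Ring.inverse (ρ.D (b + 1) (n + 1)) * ρ.D (b + 2) (n + 1)) := by
  rw [Y, if_pos ⟨b + 1, by ring⟩]
  simp only [show (2 * b + 2) / 2 = b + 1 by omega, Nat.add_sub_cancel]

lemma Y_odd (n : ℤ) (b : ℕ) : ρ.Y n (2 * b + 1) = ρ.D b n * Ring.inverse (ρ.D (b + 1) n) *
    Ring.inverse (ρ.D b (n + 1)) * ρ.D (b + 1) (n + 1) := by
  rw [Y, if_neg (Nat.not_even_iff_odd.2 ⟨b, rfl⟩)]
  simp only [show (2 * b + 1 + 1) / 2 = b + 1 by omega, Nat.add_sub_cancel]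

/-- The polynomials `E_{a,n} 𝒟_{a,n}⁻¹` satisfy the recursion `hardPoly_add_three` of the generating
polynomials of hard particle configurations. -/
lemma recursion_mul_C_D (n : ℤ) (b : ℕ) (hD : ∀ a ≤ b + 2, ∀ n, IsUnit (ρ.D a n))
    {p p' : 𝓡[X]}
    (hp : p * C (ρ.D b n) = ρ.E b n) (hp' : p' * C (ρ.D (b + 1) n) = ρ.E (b + 1) n) :
    (p' * (1 + X * C (ρ.Y n (2 * b + 3))) + p * (X * C (ρ.Y n (2 * b + 2)))) *
      C (ρ.D (b + 2) n) = ρ.E (b + 2) n := by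
  obtain ⟨d₀, hd₀⟩ := hD (b + 1) (by omega) n
  obtain ⟨d₁, hd₁⟩ := hD (b + 2) (by omega) n
  obtain ⟨e₀, he₀⟩ := hD (b + 1) (by omega) (n + 1)
  obtain ⟨e₁, he₁⟩ := hD (b + 2) (by omega) (n + 1)
  rw [show 2 * b + 3 = 2 * (b + 1) + 1 by ring, Y_odd, Y_even, ← hd₀, ← hd₁, ← he₀, ← he₁,
    Ring.inverse_unit, Ring.inverse_unit, Ring.inverse_unit]
  have hI := ρ.E_mul_D_sub b n
  have hII := ρ.E_succ_mul_D_sub (b + 1) n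
  have c11 := ρ.D_add_one_mul_D b n
  have c22 := ρ.D_add_one_mul_D (b + 1) n
  have c12 := ρ.D_succ_add_one_mul_D (b + 1) n
  have c21 := ρ.D_add_one_mul_D_succ (b + 1) n
  have c00 := ρ.D_succ_mul_D (b + 1) n
  push_cast at hI hII c11 c22 c12 c21
  rw [← hp, ← hp', ← hd₀, ← hd₁, ← he₀] at hI
  rw [← hp', ← hd₀, ← hd₁, ← he₁] at hII
  rw [← hd₀, ← he₀] at c11
  rw [← hd₁, ← he₁] at c22
  rw [← hd₀, ← he₁] at c12
  rw [← hd₁, ← he₀] at c21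
  rw [← hd₀, ← hd₁] at c00
  have key := units_mul_inv_identity d₀ d₁ e₀ e₁
    (s₁₁ := ρ.scalar (2 * ((b + 1) * (r - b)))) (s₁₂ := ρ.scalar (2 * ((b + 1) * (r - (b + 1)))))
    (s₂₂ := ρ.scalar (2 * ((b + 1 + 1) * (r - (b + 1)))))
    (by simp [hd₀, hd₁, he₀, commute_scalar_D]) (by simp [hd₀, hd₁, he₀, commute_scalar_D])
    (by simp [hd₀, hd₁, he₀, commute_scalar_D])
    (ρ.commute_scalar_mul _ _) (ρ.commute_scalar_mul _ _) c11 c21 c12 c22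
  exact add_mul_C_eq_of_mul_C_sub d₀ d₁ e₀ e₁ c00 key
    (ρ.commute_scalar_E (2 * ((b + 1) * (r - b))) (b + 1) (n - 1))
    (ρ.commute_scalar_E (2 * ((b + 1 + 1) * (r - (b + 1)))) (b + 1) (n - 1)) hI hII

/-- The configurations in `[1, 2a-1]` have the generating polynomial `E_{a,n} 𝒟_{a,n}⁻¹`. -/
lemma hardPoly_mul_C_D (hD : ∀ a ≤ r + 1, ∀ n, IsUnit (ρ.D a n)) (n : ℤ) :
    ∀ a ≤ r + 1, hardPoly (ρ.Y n) (2 * a - 1) * C (ρ.D a n) = ρ.E a n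
  | 0, _ => by simp [hardPoly_zero, D_zero, E_zero]
  | 1, _ => by
    have hE := ρ.E_succ_mul_D_sub 0 n
    have hc := ρ.D_add_one_mul_D 0 n
    have hY := ρ.Y_odd n 0
    simp only [zero_add, mul_zero, Nat.cast_zero, D_zero, E_zero, map_one, mul_one, one_mul,
      Ring.inverse_one] at hE hc hY
    rw [show 2 * 1 - 1 = 1 from rfl, hardPoly_one, hY, add_mul, one_mul, mul_assoc, ← C_mul,
      mul_assoc, hc, sub_eq_iff_eq_add'.1 hE, (ρ.commute_scalar_D _ 1 n).left_comm,
      Ring.inverse_mul_cancel_left _ _ (hD 1 (by omega) n), C_mul, ← mul_assoc, X_mul]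
  | b + 2, hb => by
    have h0 := hardPoly_mul_C_D hD n b (by omega)
    have h1 := hardPoly_mul_C_D hD n (b + 1) (by omega)
    rw [show 2 * (b + 2) - 1 = 2 * b + 3 by omega, hardPoly_add_three]
    exact ρ.recursion_mul_C_D n b (fun a ha => hD a (by omega)) h0 h1

lemma hardPoly_eq (hD : ∀ a ≤ r + 1, ∀ n, IsUnit (ρ.D a n)) (n : ℤ) :
    hardPoly (ρ.Y n) (2 * r + 1) = ρ.mulPoly (linFactor u univ) := by
  have h := ρ.hardPoly_mul_C_D hD n (r + 1) le_rfl
  rwa [D_top, C_1, mul_one, E_top] at h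

end ShiftRep

section Symmetric

variable {r : ℕ} {k : Type*} [Field k] (u : kˣ)

lemma coeff_linFactor_univ (m : ℕ) : (linFactor u univ : (RatFun r k)[X]).coeff m =
    algebraMap k (RatFun r k) ((u : k) ^ (m * r)) *
      MvPolynomial.aeval (z r k) (MvPolynomial.esymm (Fin (r + 1)) k m) := by
  have h : (linFactor u univ : (RatFun r k)[X]) =
      ∑ S : Finset (Fin (r + 1)), C (uK u ^ (#S * r) * ∏ i ∈ S, z r k i) * X ^ #S := by
    rw [linFactor, prod_one_add, powerset_univ]
    refine sum_congr rfl fun S _ => ?_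
    simp only [prod_mul_distrib, prod_const, C_mul, map_prod, C_pow, mul_comm #S r, pow_mul]
    ring
  rw [h, finsetSum_coeff, MvPolynomial.esymm, map_sum, mul_sum, ← univ_filter_card_eq, sum_filter]
  refine sum_congr rfl fun S _ => ?_
  rw [coeff_C_mul, coeff_X_pow]
  by_cases hS : #S = m
  · simp [hS, uK]
  · simp [hS, Ne.symm hS]

end Symmetric

end DualQSystem

/-! ### Inversion of formal series with a leading term -/

section PositivePart

variable {ι R : Type*} [Fintype ι] [Ring R]

/-- All degrees of `x` have nonnegative entries, with sum at least `N`. These conditions filter the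
ring, and replace the order of a series in the construction of a geometric series: the product
order of `ℤ^ι` is not linear. -/
def HahnSeries.IsPositiveOfSumGE (N : ℤ) (x : HahnSeries (ι → ℤ) R) : Prop :=
  ∀ g, x.coeff g ≠ 0 → 0 ≤ g ∧ N ≤ ∑ i, g i

namespace HahnSeries.IsPositiveOfSumGE

variable {M N : ℤ} {x y : HahnSeries (ι → ℤ) R}

lemma add (hx : x.IsPositiveOfSumGE N) (hy : y.IsPositiveOfSumGE N) :
    (x + y).IsPositiveOfSumGE N := fun g hg => by
  by_contra h
  exact hg (by
    rw [HahnSeries.coeff_add, not_imp_comm.1 (hx g) h, not_imp_comm.1 (hy g) h, add_zero])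

lemma neg (hx : x.IsPositiveOfSumGE N) : (-x).IsPositiveOfSumGE N := fun g hg =>
  hx g (by simpa using hg)

lemma sub (hx : x.IsPositiveOfSumGE N) (hy : y.IsPositiveOfSumGE N) :
    (x - y).IsPositiveOfSumGE N := sub_eq_add_neg x y ▸ hx.add hy.neg

lemma mul (hx : x.IsPositiveOfSumGE M) (hy : y.IsPositiveOfSumGE N) :
    (x * y).IsPositiveOfSumGE (M + N) := fun g hg => by
  obtain ⟨a, ha, b, hb, rfl⟩ := Set.mem_add.1 (HahnSeries.support_mul_subset hg)
  obtain ⟨ha0, haM⟩ := hx a ha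
  obtain ⟨hb0, hbN⟩ := hy b hb
  exact ⟨add_nonneg ha0 hb0, by simpa [sum_add_distrib] using add_le_add haM hbN⟩

lemma one : (1 : HahnSeries (ι → ℤ) R).IsPositiveOfSumGE 0 := fun g hg => by
  rw [HahnSeries.coeff_one] at hg
  have : g = 0 := by
    by_contra h
    simp [h] at hg
  simp [this]

lemma pow (hx : x.IsPositiveOfSumGE 1) (n : ℕ) : (x ^ n).IsPositiveOfSumGE n := by
  induction n with
  | zero => simpa using one
  | succ n ih =>
    rw [pow_succ, Nat.cast_succ]
    exact ih.mul hx

lemma eq_zero (h : ∀ n : ℕ, x.IsPositiveOfSumGE n) : x = 0 := by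
  ext g
  by_contra hg
  have := (h ((∑ i, g i).toNat + 1) g hg).2
  omega

/-- The inverse is the geometric series, in each degree a finite sum. -/
lemma isUnit_one_sub (hx : x.IsPositiveOfSumGE 1) : IsUnit (1 - x) := by
  let y : HahnSeries (ι → ℤ) R :=
    { coeff := fun g => ∑ n ∈ range ((∑ i, g i).toNat + 1), (x ^ n).coeff g
      isPWO_support' := by
        refine Set.IsPWO.mono (t := Set.Ici 0) ?_ fun g hg => ?_
        · exact Set.pi_univ_Ici (0 : ι → ℤ) ▸ Set.IsPWO.pi fun _ => (bddBelow_Ici.isWF).isPWO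
        · obtain ⟨n, -, hn⟩ := exists_ne_zero_of_sum_ne_zero hg
          exact (hx.pow n g hn).1 }
  -- The terms from the `N`-th on do not contribute to the degrees with sum below `N`.
  have hy (N : ℕ) : (y - ∑ n ∈ range N, x ^ n).IsPositiveOfSumGE N := by
    intro g hg
    rw [HahnSeries.coeff_sub, HahnSeries.coeff_sum] at hg
    by_cases h : 0 ≤ g ∧ N ≤ ∑ i, g i
    · exact h
    · exfalso
      refine hg (sub_eq_zero.2 ?_)
      by_cases h0 : 0 ≤ g
      · have hN : ∑ i, g i < N := by
          by_contra h'
          exact h ⟨h0, not_lt.1 h'⟩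
        have h0' : 0 ≤ ∑ i, g i := sum_nonneg fun i _ => h0 i
        refine sum_subset (range_subset_range.2 (by omega)) fun n _ hn => ?_
        by_contra h'
        have := (hx.pow n g h').2
        rw [mem_range] at hn
        omega
      · have (n : ℕ) : (x ^ n).coeff g = 0 := by
          by_contra h'
          exact h0 (hx.pow n g h').1
        simp [y, this]
  have hx0 : (1 - x).IsPositiveOfSumGE 0 := one.sub fun g hg =>
    ⟨(hx g hg).1, zero_le_one.trans (hx g hg).2⟩
  refine ⟨⟨1 - x, y, sub_eq_zero.1 <| eq_zero fun N => ?_,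
    sub_eq_zero.1 <| eq_zero fun N => ?_⟩, rfl⟩
  · have h := hx0.mul (hy N)
    rw [mul_sub, mul_neg_geom_sum, zero_add] at h
    have := h.sub (hx.pow N)
    rwa [show (1 - x) * y - (1 - x ^ N) - x ^ N = (1 - x) * y - 1 by abel] at this
  · have h := (hy N).mul hx0
    rw [sub_mul, geom_sum_mul_neg, add_zero] at h
    have := h.sub (hx.pow N)
    rwa [show y * (1 - x) - (1 - x ^ N) - x ^ N = y * (1 - x) - 1 by abel] at this

end HahnSeries.IsPositiveOfSumGE

/-- A finite formal sum with a least degree, whose leading coefficient is invertible, is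
invertible. -/
lemma HahnSeries.isUnit_sum_single {A : Type*} {s : Finset A} {d : A → ι → ℤ} {l : A → R} {a : A}
    (ha : a ∈ s) (hl : IsUnit (l a)) (hd : ∀ b ∈ s, b ≠ a → d a < d b) :
    IsUnit (∑ b ∈ s, HahnSeries.single (d b) (l b)) := by
  classical
  obtain ⟨t, ht⟩ := hl
  have hunit : IsUnit (HahnSeries.single (d a) (t : R)) :=
    ⟨⟨HahnSeries.single (d a) (t : R), HahnSeries.single (-d a) (↑t⁻¹ : R),
      by simp [HahnSeries.single_mul_single], by simp [HahnSeries.single_mul_single]⟩, rfl⟩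
  -- After division by the leading term, the sum is `1 - x` with `x` of positive degrees.
  have hx : (-∑ b ∈ s.erase a, HahnSeries.single (d b - d a) (↑t⁻¹ * l b)).IsPositiveOfSumGE 1 := by
    refine IsPositiveOfSumGE.neg (sum_induction _ _ (fun _ _ => IsPositiveOfSumGE.add)
      (fun g hg => (hg rfl).elim) fun b hb g hg => ?_)
    have hg' : g = d b - d a := by
      by_contra h
      exact hg (HahnSeries.coeff_single_of_ne h)
    obtain ⟨h0, i, hi⟩ := Pi.lt_def.1 (hd b (mem_of_mem_erase hb) (ne_of_mem_erase hb))
    subst hg'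
    refine ⟨sub_nonneg.2 h0, ?_⟩
    have := sum_pos' (s := univ) (f := d b - d a) (fun i _ => sub_nonneg.2 (h0 i))
      ⟨i, mem_univ i, sub_pos.2 hi⟩
    omega
  convert hunit.mul hx.isUnit_one_sub using 1
  rw [sub_neg_eq_add, mul_add, mul_one, mul_sum, ← add_sum_erase s _ ha, ht]
  congr 1
  refine sum_congr rfl fun b _ => ?_
  rw [HahnSeries.single_mul_single, add_sub_cancel, ← mul_assoc, ← ht, Units.mul_inv, one_mul]

end PositivePart

namespace DualQSystem

/-! ### The currents as formal difference operators -/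

section Invertible

variable {r : ℕ} {k : Type*} [Field k] (u : kˣ) (σ : Equiv.Perm (Fin (r + 1)))

/-- Among the `I` of size `a`, the set of the first `a` variables has the strictly least degree: it
has `min(i, a)` elements among the first `i` variables, and no other `I` attains this maximum for
all `i`; it fails at `i = a`. -/
lemma shiftDegree_lt {I : Finset (Fin (r + 1))} {a : ℕ} (ha : a ≤ r + 1) (hI : #I = a)
    (hI' : I ≠ ({l | (l : ℕ) < a} : Finset (Fin (r + 1))).map σ.toEmbedding) :
    shiftDegree σ (({l | (l : ℕ) < a} : Finset (Fin (r + 1))).map σ.toEmbedding) <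
      shiftDegree σ I := by
  have hc : #({l | (l : ℕ) < a} : Finset (Fin (r + 1))) = a := by
    rw [Fin.card_filter_val_lt]; omega
  have hle (i : Fin r) : #{l | l ≤ i.castSucc ∧ σ l ∈ I} ≤
      #{l : Fin (r + 1) | l ≤ i.castSucc ∧ (l : ℕ) < a} := by
    rcases le_total a (i + 1) with h | h
    · have : ({l : Fin (r + 1) | l ≤ i.castSucc ∧ (l : ℕ) < a} : Finset _) =
          ({l | (l : ℕ) < a} : Finset (Fin (r + 1))) := by
        ext l
        simp only [mem_filter, mem_univ, true_and, Fin.le_def, Fin.val_castSucc]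
        omega
      rw [this, hc, ← hI, ← card_map σ.toEmbedding]
      refine card_le_card fun j hj => ?_
      obtain ⟨l, hl, rfl⟩ := mem_map.1 hj
      exact (mem_filter.1 hl).2.2
    · refine card_le_card fun l hl => ?_
      simp only [mem_filter, mem_univ, true_and, Fin.le_def, Fin.val_castSucc] at hl ⊢
      omega
  have hpos : (0 : ℤ) < r + 1 := by positivity
  have hd (J : Finset (Fin (r + 1))) (i : Fin r) : shiftDegree σ J i =
      ((i : ℤ) + 1) * #J - ((r : ℤ) + 1) * #{l | l ≤ i.castSucc ∧ σ l ∈ J} := rfl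
  rw [Pi.lt_def]
  constructor
  · intro i
    rw [hd, hd, card_map, hc, hI]
    simp only [mem_map_equiv, Equiv.symm_apply_apply, mem_filter, mem_univ, true_and]
    have := mul_le_mul_of_nonneg_left (Nat.cast_le (α := ℤ).2 (hle i)) hpos.le
    linarith
  · have ha0 : 0 < a := by
      by_contra h0
      obtain rfl : a = 0 := by omega
      exact hI' (by rw [card_eq_zero.1 hI]; simp)
    have har : a - 1 < r := by
      by_contra h0
      obtain rfl : a = r + 1 := by omega
      refine hI' ?_
      rw [(card_eq_iff_eq_univ I).1 (by simpa using hI)]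
      symm
      rw [← card_eq_iff_eq_univ, card_map, hc, Fintype.card_fin]
    -- The entry of index `a - 1` counts the elements of `I` among the first `a` variables.
    refine ⟨⟨a - 1, har⟩, ?_⟩
    rw [hd, hd, card_map, hc, hI]
    simp only [mem_map_equiv, Equiv.symm_apply_apply, mem_filter, mem_univ, true_and]
    refine sub_lt_sub_left (mul_lt_mul_of_pos_left (Nat.cast_lt.2 ?_) hpos) _
    have heq : ({l : Fin (r + 1) | l ≤ (⟨a - 1, har⟩ : Fin r).castSucc ∧ (l : ℕ) < a} : Finset _) =
        ({l | (l : ℕ) < a} : Finset (Fin (r + 1))) := by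
      ext l
      simp only [mem_filter, mem_univ, true_and, Fin.le_def, Fin.val_castSucc]
      omega
    refine lt_of_le_of_ne (hle _) fun h => hI' ?_
    rw [heq, hc] at h
    symm
    have h1 : ({l : Fin (r + 1) | l ≤ (⟨a - 1, har⟩ : Fin r).castSucc ∧ σ l ∈ I} : Finset _) =
        ({l | (l : ℕ) < a} : Finset (Fin (r + 1))) := by
      refine eq_of_subset_of_card_le (fun l hl => ?_) (by rw [h, hc])
      simp only [mem_filter, mem_univ, true_and, Fin.le_def, Fin.val_castSucc] at hl ⊢
      omega
    refine eq_of_subset_of_card_le (fun _ hj => ?_) (by rw [card_map, hc, hI])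
    obtain ⟨l, hl, rfl⟩ := mem_map.1 hj
    rw [← h1] at hl
    exact (mem_filter.1 hl).2.2

lemma aCoeff_ne_zero (I : Finset (Fin (r + 1))) : aCoeff k I ≠ 0 :=
  prod_ne_zero_iff.2 fun i hi => prod_ne_zero_iff.2 fun _ hj =>
    div_ne_zero (z_ne_zero r k i) (sub_ne_zero.2 fun h =>
      mem_compl.1 hj (z_injective r k h ▸ hi))

lemma isUnit_Dop {a : ℕ} (ha : a ≤ r + 1) (n : ℤ) : IsUnit (Dop (k := k) u σ a n) := by
  rw [Dop, smul_eq_mulOpHom_mul]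
  refine ((IsUnit.mk0 _ ?_).map (mulOpHom r k)).mul
    (HahnSeries.isUnit_sum_single
      (a := ({l | (l : ℕ) < a} : Finset (Fin (r + 1))).map σ.toEmbedding) ?_ ?_ fun I hI hI' =>
        shiftDegree_lt σ ha (mem_powersetCard_univ.1 hI) hI')
  · simp only [ne_eq, map_eq_zero, Units.ne_zero, not_false_eq_true]
  · rw [mem_powersetCard_univ, card_map, Fin.card_filter_val_lt]
    omega
  · rw [Module.End.isUnit_iff]
    exact (Equiv.mulLeft₀ _ (mul_ne_zero (zpow_ne_zero _ (prod_z_ne_zero _))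
      (aCoeff_ne_zero _))).bijective.comp (shift u _).bijective

lemma Y_eq (n : ℤ) {i : ℕ} (hi : i ∈ Icc 1 (2 * r + 1)) :
    Y (k := k) u σ n i = (formalRep u σ).Y n i := by
  rw [mem_Icc] at hi
  rw [Y, ShiftRep.Y, Yeven, Yodd]
  split_ifs with h
  · obtain ⟨j, rfl⟩ := h
    rw [Dop_eq_D u σ (by omega), Dop_eq_D u σ (by omega), Dop_eq_D u σ (by omega),
      Dop_eq_D u σ (by omega)]
  · rw [Dop_eq_D u σ (by omega), Dop_eq_D u σ (by omega), Dop_eq_D u σ (by omega),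
      Dop_eq_D u σ (by omega)]

lemma Cons_eq_coeff_hardPoly (n : ℤ) (m : ℕ) :
    Cons (k := k) u σ n m = (hardPoly ((formalRep u σ).Y n) (2 * r + 1)).coeff m := by
  rw [coeff_hardPoly, Cons]
  refine sum_congr rfl fun S hS => congrArg List.prod <| List.map_congr_left fun i hi =>
    Y_eq u σ n ?_
  exact (mem_powersetCard.1 (mem_filter.1 hS).1).1 ((mem_sort _).1 hi)

end Invertible

end DualQSystem

theorem mainTheorem7 {k : Type*} [Field k] (u : kˣ) (r : ℕ)
    (σ : Equiv.Perm (Fin (r + 1))) :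
    (∀ a ≤ r + 1, ∀ n : ℤ, IsUnit (DualQSystem.Dop u σ a n)) ∧
    ∀ m ≤ r + 1, ∀ n : ℤ,
      DualQSystem.Cons u σ n m =
        DualQSystem.mulOp (algebraMap k (DualQSystem.RatFun r k) ((u : k) ^ (m * r)) *
          MvPolynomial.aeval (DualQSystem.z r k) (MvPolynomial.esymm (Fin (r + 1)) k m)) := by
  refine ⟨fun a ha n => DualQSystem.isUnit_Dop u σ ha n, fun m _ n => ?_⟩
  rw [DualQSystem.Cons_eq_coeff_hardPoly, DualQSystem.ShiftRep.hardPoly_eq _ fun a ha n =>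
    DualQSystem.Dop_eq_D u σ ha n ▸ DualQSystem.isUnit_Dop u σ ha n,
    DualQSystem.ShiftRep.mulPoly, coe_mapRingHom, coeff_map, DualQSystem.coeff_linFactor_univ]
  rfl
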